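/- Let $-1<\rho<1$, $\theta\in\mathbb R$, $p\in\mathbb R$, $a\ge 0$, $b>0$, with $p>0$ if $a=0$. Let $W\sim GIG(p,a,b)$, i.e. $W$ has density $$\frac{1}{2\overline K_p(a,b)}\,w^{p-1}\exp\!\big(-\tfrac12(a^2w^{-1}+b^2w)\big),\qquad w>0,$$ where $\overline K_p(a,b)=(a/b)^pK_p(ab)$ if $a>0$ and $\overline K_p(0,b)=b^{-2p}\Gamma(p)2^{p-1}$, $K_p$ being the modified Bessel function of the second kind. Let $Z=(Z_1,Z_2)$ be independent of $W$, centred bivariate normal with unit variances and correlation $\rho$. Let $X=(X_1,X_2)$ have the equi-skew bivariate generalized hyperbolic law, that is, the law of $(\theta W+\sqrt W Z_1,\ \theta W+\sqrt W Z_2)$. Put $$\alpha=\sqrt{\tfrac{1-\rho}{1+\rho}},\quad \beta=\big(\theta^2(1+\alpha^2)+b^2\big)^{1/2},\quad \varphi(\alpha)=\beta(1+\alpha^2)^{1/2}+\alpha^2\theta,\quad \tilde\theta(0)=\frac{(1+\alpha^2)^{\frac12(p-\frac12)}}{\alpha\big(\beta+\theta(1+\alpha^2)^{1/2}\big)}.$$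 Then $\max(Z_1,Z_2)$ has the skew normal law with parameter $\alpha$ (density $2\,n(z)N(\alpha z)$, where $n$ and $N$ are the standard normal density and distribution function), and with $X^*=\theta W+\sqrt W\max(Z_1,Z_2)$ one has $P(X_1\le y,X_2\le y)=P(X^*\le y)$ for all $y\in\mathbb R$. Moreover $\varphi(\alpha)+\theta=(1+\alpha^2)^{1/2}\big(\beta+\theta(1+\alpha^2)^{1/2}\big)>0$, the constant $$K=\frac{\tilde\theta(0)}{\sqrt{2\pi}\,\overline K_p(a,b)\,\beta^{p-\frac12}\,(\varphi(\alpha)+\theta)}$$ is positive, and as $y\to-\infty$ $$P(X_1\le y,\,X_2\le y)=P(X^*\le y)=K\,|y|^{p-\frac32}\,e^{-|y|(\varphi(\alpha)+\theta)}\Big(1+O\big(\tfrac1{|y|}\big)\Big),$$ where the constant in the $O$-term may depend on the parameters $\rho,\theta,p,a,b$. -/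

import Mathlib

open MeasureTheory ProbabilityTheory Filter Topology Asymptotics

noncomputable section

namespace EquiSkewGH

/-- The modified Bessel function of the second kind `K_ν(ω)` (`ν` real, `ω > 0`), through its
standard integral representation `½ ∫₀^∞ u^(ν-1) exp(-(ω/2)(u + 1/u)) du`
(equivalently, with `u = exp t`, `∫₀^∞ exp(-ω cosh t) cosh(ν t) dt`). -/
def besselK (ν ω : ℝ) : ℝ :=
  (1 / 2) * ∫ u in Set.Ioi (0 : ℝ), u ^ (ν - 1) * Real.exp (-(ω / 2) * (u + u⁻¹))

/-- The normalizing function `K̄_p(a,b)` of the generalized inverse Gaussian density; the three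
branches are meant for `a, b > 0`, for `a = 0` and `p, b > 0`, and for `b = 0`, `a > 0`, `p < 0`. -/
def barK (p a b : ℝ) : ℝ :=
  if a = 0 then b ^ (-2 * p) * Real.Gamma p * 2 ^ (p - 1)
  else if b = 0 then a ^ (2 * p) * Real.Gamma (-p) * 2 ^ (-p - 1)
  else (a / b) ^ p * besselK p (a * b)

/-- The density of `GIG(p,a,b)`. -/
def gigPDF (p a b w : ℝ) : ℝ :=
  if 0 < w then
    1 / (2 * barK p a b) * w ^ (p - 1) * Real.exp (-(1 / 2) * (a ^ 2 * w⁻¹ + b ^ 2 * w))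
  else 0

/-- The generalized inverse Gaussian law `GIG(p,a,b)`. -/
def gig (p a b : ℝ) : Measure ℝ :=
  volume.withDensity fun w => ENNReal.ofReal (gigPDF p a b w)

/-- The centred bivariate normal law `N(0,R)` with unit variances and correlation `ρ`. -/
def bivariateNormal (ρ : ℝ) : Measure (EuclideanSpace ℝ (Fin 2)) :=
  multivariateGaussian 0 !![1, ρ; ρ, 1]

/-- The skew bivariate generalized hyperbolic law `GH(0,R,θ,p,a,b)`: the law of `W θ + √W Z` for
independent `W ∼ GIG(p,a,b)` and `Z ∼ N(0,R)`. -/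
def bivariateGH (ρ : ℝ) (θ : EuclideanSpace ℝ (Fin 2)) (p a b : ℝ) :
    Measure (EuclideanSpace ℝ (Fin 2)) :=
  ((gig p a b).prod (bivariateNormal ρ)).map fun q => q.1 • θ + Real.sqrt q.1 • q.2

/-- The skew normal law with parameter `α`, of density `z ↦ 2 φ(z) Φ(α z)`, where `φ` and `Φ` are
the standard normal density and distribution function. -/
def skewNormal (α : ℝ) : Measure ℝ :=
  volume.withDensity fun z =>
    ENNReal.ofReal (2 * gaussianPDFReal 0 1 z * cdf (gaussianReal 0 1) (α * z))

/-- `α = √((1-ρ)/(1+ρ))`. -/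
def skewParam (ρ : ℝ) : ℝ := Real.sqrt ((1 - ρ) / (1 + ρ))

/-- `β = √(θ²(1+α²) + b²)`. -/
def betaParam (α θ b : ℝ) : ℝ := Real.sqrt (θ ^ 2 * (1 + α ^ 2) + b ^ 2)

/-- `φ(α) = β (1+α²)^(1/2) + α² θ`. -/
def phiAlpha (α θ b : ℝ) : ℝ :=
  betaParam α θ b * Real.sqrt (1 + α ^ 2) + α ^ 2 * θ

/-- `θ̃(0) = (1+α²)^((p-1/2)/2) / (α (β + θ (1+α²)^(1/2)))`. -/
def thetaTildeZero (α θ p b : ℝ) : ℝ :=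
  (1 + α ^ 2) ^ ((p - 1 / 2) / 2) /
    (α * (betaParam α θ b + θ * Real.sqrt (1 + α ^ 2)))

/-- The constant `θ̃(0) / (√(2π) K̄_p(a,b) β^(p-1/2) (φ(α)+θ))`. -/
def tailConst (α θ p a b : ℝ) : ℝ :=
  thetaTildeZero α θ p b /
    (Real.sqrt (2 * Real.pi) * barK p a b * betaParam α θ b ^ (p - 1 / 2) *
      (phiAlpha α θ b + θ))

end EquiSkewGH

end

noncomputable section

namespace EquiSkewGH

/-! Both coordinates share θ and W, so the joint lower tail at y is the tail of θW + √W max(Z₁, Z₂).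
The maximum is skew normal (`map_max_bivariateNormal`), and conditioning on W gives the integral
over w of the GIG density times F((y - θw)/√w), with F the skew normal distribution function
(`measureReal_prod_eq_integral`).

A Mills-type estimate gives F(-x) = A exp(-(1+α²)x²/2)/x² up to relative error O(1/x²). Put t = |y|
and w = tu: the exponent is t times a phase of the form c/u + c'u + const. With u = u₀ eˣ, u₀ the
minimizer, this phase is exactly φ(α) + θ + s β (cosh x - 1), where s = √(1+α²) (`phase_identity`).

Near x = 0 Laplace's method applies (`laplace_cosh`). The amplitude is known to first order in x up
to O(x² + 1/t) (`amplitude_expansion`); its linear term cancels by symmetry, so the relative error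
is O(1/t). Away from x = 0 the exponent exceeds its minimum by a fixed amount, so the rest is
exponentially smaller (`setIntegral_away_from_saddle`). Finally `tailConst_eq` matches the
constants. -/

/-! ### The bivariate normal law and its maximum. -/

theorem posSemidef_corr {ρ : ℝ} (h₁ : -1 < ρ) (h₂ : ρ < 1) :
    (!![1, ρ; ρ, 1] : Matrix (Fin 2) (Fin 2) ℝ).PosSemidef := by
  refine Matrix.PosSemidef.of_dotProduct_mulVec_nonneg ?_ fun x => ?_
  · ext i j
    fin_cases i <;> fin_cases j <;> simp
  · simp only [Matrix.mulVec, dotProduct, Fin.sum_univ_two, Matrix.of_apply, Matrix.cons_val_zero,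
      Matrix.cons_val_one, star_trivial, Pi.star_apply, Matrix.cons_val', Matrix.cons_val_fin_one]
    -- The quadratic form is ½[(1+ρ)(x₀+x₁)² + (1-ρ)(x₀-x₁)²].
    nlinarith [mul_nonneg (by linarith : 0 ≤ 1 + ρ) (sq_nonneg (x 0 + x 1)),
      mul_nonneg (by linarith : 0 ≤ 1 - ρ) (sq_nonneg (x 0 - x 1))]

/-- A linear image of two independent standard normal variables with the right covariances is
bivariate normal. -/
theorem bivariateNormal_eq_map {ρ : ℝ} (h₁ : -1 < ρ) (h₂ : ρ < 1) {k l m n : ℝ}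
    (hkl : k ^ 2 + l ^ 2 = 1) (hmn : m ^ 2 + n ^ 2 = 1) (hc : k * m + l * n = ρ) :
    bivariateNormal ρ = ((gaussianReal 0 1).prod (gaussianReal 0 1)).map
      fun q => !₂[k * q.1 + l * q.2, m * q.1 + n * q.2] := by
  have hmeas : Measurable fun q : ℝ × ℝ =>
      (!₂[k * q.1 + l * q.2, m * q.1 + n * q.2] : EuclideanSpace ℝ (Fin 2)) := by
    refine (WithLp.measurable_toLp 2 _).comp (measurable_pi_iff.2 fun i => ?_)
    fin_cases i
    · exact (measurable_fst.const_mul k).add (measurable_snd.const_mul l)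
    · exact (measurable_fst.const_mul m).add (measurable_snd.const_mul n)
  have : IsProbabilityMeasure (((gaussianReal 0 1).prod (gaussianReal 0 1)).map
      fun q : ℝ × ℝ => (!₂[k * q.1 + l * q.2, m * q.1 + n * q.2] : EuclideanSpace ℝ (Fin 2))) :=
    Measure.isProbabilityMeasure_map hmeas.aemeasurable
  rw [bivariateNormal]
  apply Measure.ext_of_charFun
  ext t
  rw [charFun_multivariateGaussian (posSemidef_corr h₁ h₂), charFun_apply,
    integral_map hmeas.aemeasurable (by fun_prop)]
  have : ∀ q : ℝ × ℝ, Complex.exp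
      (((inner ℝ (!₂[k * q.1 + l * q.2, m * q.1 + n * q.2] : EuclideanSpace ℝ (Fin 2)) t : ℝ) : ℂ)
        * Complex.I) =
      Complex.exp ((k * t 0 + m * t 1 : ℝ) * q.1 * Complex.I) *
      Complex.exp ((l * t 0 + n * t 1 : ℝ) * q.2 * Complex.I) := by
    intro q
    rw [← Complex.exp_add]
    congr 1
    simp [PiLp.inner_apply]
    ring
  simp_rw [this]
  rw [integral_prod_mul (fun x : ℝ => Complex.exp ((k * t 0 + m * t 1 : ℝ) * x * Complex.I))
    (fun x : ℝ => Complex.exp ((l * t 0 + n * t 1 : ℝ) * x * Complex.I)),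
    ← charFun_apply_real, ← charFun_apply_real, charFun_gaussianReal, charFun_gaussianReal,
    ← Complex.exp_add]
  congr 1
  simp only [inner_zero_right, dotProduct, Matrix.mulVec, Fin.sum_univ_two, Matrix.of_apply,
    Matrix.cons_val_zero, Matrix.cons_val_one, Matrix.cons_val', Matrix.cons_val_fin_one]
  push_cast
  have e1 : (k : ℂ) ^ 2 + l ^ 2 = 1 := by exact_mod_cast hkl
  have e2 : (m : ℂ) ^ 2 + n ^ 2 = 1 := by exact_mod_cast hmn
  have e3 : (k : ℂ) * m + l * n = ρ := by exact_mod_cast hc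
  linear_combination ((t 0 : ℂ) ^ 2 / 2) * e1 + ((t 1 : ℂ) ^ 2 / 2) * e2 + (t 0 : ℂ) * t 1 * e3

theorem skewParam_pos {ρ : ℝ} (h₁ : -1 < ρ) (h₂ : ρ < 1) : 0 < skewParam ρ :=
  Real.sqrt_pos.2 (div_pos (by linarith) (by linarith))

theorem sqrt_one_sub_sq_mul_skewParam {ρ : ℝ} (h₁ : -1 < ρ) (h₂ : ρ < 1) :
    Real.sqrt (1 - ρ ^ 2) * skewParam ρ = 1 - ρ := by
  rw [skewParam, ← Real.sqrt_mul (by nlinarith)]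
  have : 1 + ρ ≠ 0 := by linarith
  rw [show (1 - ρ ^ 2) * ((1 - ρ) / (1 + ρ)) = (1 - ρ) ^ 2 by field_simp; ring]
  exact Real.sqrt_sq (by linarith)

theorem measurable_cdf_gaussian : Measurable (cdf (gaussianReal 0 1)) :=
  (monotone_cdf _).measurable

theorem skewNormal_apply (α : ℝ) {A : Set ℝ} (hA : MeasurableSet A) :
    skewNormal α A = 2 * ∫⁻ x in A, ENNReal.ofReal (cdf (gaussianReal 0 1) (α * x))
      ∂(gaussianReal 0 1) := by
  have hm : Measurable fun x => ENNReal.ofReal (cdf (gaussianReal 0 1) (α * x)) :=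
    (measurable_cdf_gaussian.comp (measurable_const_mul α)).ennreal_ofReal
  rw [skewNormal, withDensity_apply _ hA, gaussianReal_of_var_ne_zero _ one_ne_zero,
    setLIntegral_withDensity_eq_setLIntegral_mul _ (measurable_gaussianPDF _ _)
      (gaussianReal_of_var_ne_zero 0 one_ne_zero ▸ hm) hA,
    ← lintegral_const_mul _ ((measurable_gaussianPDF _ _).mul
      (gaussianReal_of_var_ne_zero 0 one_ne_zero ▸ hm))]
  refine lintegral_congr fun x => ?_
  rw [ENNReal.ofReal_mul (mul_nonneg zero_le_two (gaussianPDFReal_nonneg _ _ _)),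
    ENNReal.ofReal_mul zero_le_two, Pi.mul_apply, gaussianPDF, mul_assoc]
  simp

/-- The maximum of two correlated standard normal variables is skew normal. -/
theorem map_max_bivariateNormal {ρ : ℝ} (h₁ : -1 < ρ) (h₂ : ρ < 1) :
    (bivariateNormal ρ).map (fun z => max (z 0) (z 1)) = skewNormal (skewParam ρ) := by
  set σ := Real.sqrt (1 - ρ ^ 2) with hσ
  have hσ0 : 0 < σ := Real.sqrt_pos.2 (by nlinarith)
  have hσ2 : ρ ^ 2 + σ ^ 2 = 1 := by rw [hσ, Real.sq_sqrt (by nlinarith)]; ring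
  have hσα := sqrt_one_sub_sq_mul_skewParam h₁ h₂
  rw [← hσ] at hσα
  have c0 : Measurable fun z : EuclideanSpace ℝ (Fin 2) => z 0 := by fun_prop
  have c1 : Measurable fun z : EuclideanSpace ℝ (Fin 2) => z 1 := by fun_prop
  have hf : ∀ k l m n : ℝ, Measurable fun q : ℝ × ℝ =>
      (!₂[k * q.1 + l * q.2, m * q.1 + n * q.2] : EuclideanSpace ℝ (Fin 2)) := by
    intro k l m n
    refine (WithLp.measurable_toLp 2 _).comp (measurable_pi_iff.2 fun i => ?_)
    fin_cases i
    · exact (measurable_fst.const_mul k).add (measurable_snd.const_mul l)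
    · exact (measurable_fst.const_mul m).add (measurable_snd.const_mul n)
  ext A hA
  rw [Measure.map_apply (c0.max c1) hA, skewNormal_apply _ hA]
  have hS1 : MeasurableSet {z : EuclideanSpace ℝ (Fin 2) | z 1 ≤ z 0 ∧ z 0 ∈ A} :=
    (measurableSet_le c1 c0).inter (c0 hA)
  have hS2 : MeasurableSet {z : EuclideanSpace ℝ (Fin 2) | z 0 < z 1 ∧ z 1 ∈ A} :=
    (measurableSet_lt c0 c1).inter (c1 hA)
  have hU : (fun z : EuclideanSpace ℝ (Fin 2) => max (z 0) (z 1)) ⁻¹' A =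
      {z | z 1 ≤ z 0 ∧ z 0 ∈ A} ∪ {z | z 0 < z 1 ∧ z 1 ∈ A} := by
    ext z
    rcases le_or_gt (z 1) (z 0) with h | h
    · simp [h, not_lt.2 h]
    · simp [h, h.le, not_le.2 h]
  have hd : Disjoint {z : EuclideanSpace ℝ (Fin 2) | z 1 ≤ z 0 ∧ z 0 ∈ A}
      {z | z 0 < z 1 ∧ z 1 ∈ A} := by
    rw [Set.disjoint_left]
    rintro z ⟨h, -⟩ ⟨h', -⟩
    exact absurd h (not_le.2 h')
  -- Write Z₁ = x and Z₂ = ρx + σy with x, y independent standard normal. Then Z₂ ≤ Z₁ means y ≤ αx,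
  -- because (1-ρ)/σ = α.
  have E1 : bivariateNormal ρ {z | z 1 ≤ z 0 ∧ z 0 ∈ A} =
      ∫⁻ x in A, ENNReal.ofReal (cdf (gaussianReal 0 1) (skewParam ρ * x)) ∂(gaussianReal 0 1) := by
    rw [bivariateNormal_eq_map h₁ h₂ (k := 1) (l := 0) (m := ρ) (n := σ) (by norm_num) hσ2
      (by ring), Measure.map_apply (hf _ _ _ _) hS1, Measure.prod_apply (hf _ _ _ _ hS1),
      ← lintegral_indicator hA]
    refine lintegral_congr fun x => ?_
    by_cases hx : x ∈ A
    · rw [Set.indicator_of_mem hx, ofReal_cdf]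
      congr 1
      ext y
      have : ρ * x + σ * y ≤ x ↔ y ≤ skewParam ρ * x := by
        rw [← mul_le_mul_iff_right₀ hσ0 (b := y), ← mul_assoc, hσα]
        constructor <;> intro h <;> linarith
      simpa [hx] using this
    · rw [Set.indicator_of_notMem hx]
      simp [hx]
  -- Same with the roles exchanged; the strict inequality costs nothing since the normal law has no
  -- atoms.
  have E2 : bivariateNormal ρ {z | z 0 < z 1 ∧ z 1 ∈ A} =
      ∫⁻ x in A, ENNReal.ofReal (cdf (gaussianReal 0 1) (skewParam ρ * x)) ∂(gaussianReal 0 1) := by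
    rw [bivariateNormal_eq_map h₁ h₂ (k := ρ) (l := σ) (m := 1) (n := 0) hσ2 (by norm_num)
      (by ring), Measure.map_apply (hf _ _ _ _) hS2, Measure.prod_apply (hf _ _ _ _ hS2),
      ← lintegral_indicator hA]
    refine lintegral_congr fun x => ?_
    by_cases hx : x ∈ A
    · have := nullSingletonClass_gaussianReal (μ := 0) (v := 1) one_ne_zero
      rw [Set.indicator_of_mem hx, ofReal_cdf, ← measure_congr Iio_ae_eq_Iic]
      congr 1
      ext y
      have : ρ * x + σ * y < x ↔ y < skewParam ρ * x := by
        rw [← mul_lt_mul_iff_right₀ hσ0 (b := y), ← mul_assoc, hσα]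
        constructor <;> intro h <;> linarith
      simpa [hx] using this
    · rw [Set.indicator_of_notMem hx]
      simp [hx]
  rw [hU, measure_union hd hS2, E1, E2, two_mul]

theorem hasLaw_max {ρ : ℝ} (h₁ : -1 < ρ) (h₂ : ρ < 1) {Ω' : Type*} [MeasurableSpace Ω']
    {P' : Measure Ω'} {Z : Ω' → EuclideanSpace ℝ (Fin 2)}
    (hZ : HasLaw Z (bivariateNormal ρ) P') :
    HasLaw (fun ω => max (Z ω 0) (Z ω 1)) (skewNormal (skewParam ρ)) P' := by
  have hm : Measurable fun z : EuclideanSpace ℝ (Fin 2) => max (z 0) (z 1) :=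
    Measurable.max (by fun_prop) (by fun_prop)
  refine ⟨hm.comp_aemeasurable hZ.aemeasurable, ?_⟩
  rw [← map_max_bivariateNormal h₁ h₂, ← hZ.map_eq,
    AEMeasurable.map_map_of_aemeasurable hm.aemeasurable hZ.aemeasurable]
  rfl

instance isProbabilityMeasure_bivariateNormal (ρ : ℝ) :
    IsProbabilityMeasure (bivariateNormal ρ) := by
  unfold bivariateNormal; infer_instance

/-- Total mass one is inherited from the image of the bivariate normal law, so the density need not
be integrated. -/
theorem isProbabilityMeasure_skewNormal {ρ : ℝ} (h₁ : -1 < ρ) (h₂ : ρ < 1) :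
    IsProbabilityMeasure (skewNormal (skewParam ρ)) := by
  rw [← map_max_bivariateNormal h₁ h₂]
  exact Measure.isProbabilityMeasure_map
    (Measurable.max (by fun_prop) (by fun_prop)).aemeasurable

/-! ### Reduction to a one-dimensional mixture integral. -/

theorem max_le_iff_scaled {w θ y u v : ℝ} :
    (θ * w + Real.sqrt w * u ≤ y ∧ θ * w + Real.sqrt w * v ≤ y) ↔
      θ * w + Real.sqrt w * max u v ≤ y := by
  rw [mul_max_of_nonneg _ _ (Real.sqrt_nonneg w), ← max_add_add_left, max_le_iff]

/-- The mixture representation of the joint lower tail. -/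
theorem measureReal_lower_orthant {ρ θ p a b : ℝ} [IsProbabilityMeasure (gig p a b)]
    {Ω : Type*} [MeasurableSpace Ω] {P : Measure Ω} {X : Ω → EuclideanSpace ℝ (Fin 2)}
    (hX : HasLaw X (bivariateGH ρ !₂[θ, θ] p a b) P) (y : ℝ) :
    P.real {ω | X ω 0 ≤ y ∧ X ω 1 ≤ y} =
      ((gig p a b).prod (bivariateNormal ρ)).real
        {q | θ * q.1 + Real.sqrt q.1 * max (q.2 0) (q.2 1) ≤ y} := by
  have hS : MeasurableSet {x : EuclideanSpace ℝ (Fin 2) | x 0 ≤ y ∧ x 1 ≤ y} :=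
    (measurableSet_le (f := fun x : EuclideanSpace ℝ (Fin 2) => x 0) (by fun_prop)
      measurable_const).inter
      (measurableSet_le (f := fun x : EuclideanSpace ℝ (Fin 2) => x 1) (by fun_prop)
      measurable_const)
  have hg : Measurable fun q : ℝ × EuclideanSpace ℝ (Fin 2) =>
      q.1 • (!₂[θ, θ] : EuclideanSpace ℝ (Fin 2)) + Real.sqrt q.1 • q.2 := by fun_prop
  rw [hX.measureReal_eq hS, bivariateGH, map_measureReal_apply hg hS]
  congr 1
  ext q
  simp only [Set.mem_preimage, Set.mem_ofPred_eq, PiLp.add_apply, PiLp.smul_apply, smul_eq_mul,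
    Matrix.cons_val_zero, Matrix.cons_val_one, Matrix.cons_val_fin_one]
  rw [mul_comm q.1 θ]
  exact max_le_iff_scaled

theorem measureReal_scaled_max {ρ θ p a b : ℝ} [IsProbabilityMeasure (gig p a b)]
    {Ω' : Type*} [MeasurableSpace Ω'] {P' : Measure Ω'} [IsProbabilityMeasure P']
    {W : Ω' → ℝ} {Z : Ω' → EuclideanSpace ℝ (Fin 2)} (hW : HasLaw W (gig p a b) P')
    (hZ : HasLaw Z (bivariateNormal ρ) P') (hWZ : IndepFun W Z P') (y : ℝ) :
    P'.real {ω | θ * W ω + Real.sqrt (W ω) * max (Z ω 0) (Z ω 1) ≤ y} =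
      ((gig p a b).prod (bivariateNormal ρ)).real
        {q | θ * q.1 + Real.sqrt q.1 * max (q.2 0) (q.2 1) ≤ y} := by
  have hl := (indepFun_iff_hasLaw_prodMk_prod hW hZ).1 hWZ
  have hS : MeasurableSet {q : ℝ × EuclideanSpace ℝ (Fin 2) |
      θ * q.1 + Real.sqrt q.1 * max (q.2 0) (q.2 1) ≤ y} :=
    measurableSet_le (by fun_prop) (by fun_prop)
  exact hl.measureReal_eq hS

theorem measurable_gigPDF (p a b : ℝ) : Measurable (gigPDF p a b) := by
  unfold gigPDF
  exact Measurable.ite measurableSet_Ioi (by fun_prop) measurable_const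

/-- If the normalizer were not positive, the density would be nonpositive and the measure zero.
Positivity thus needs no study of the Bessel function. -/
theorem barK_pos {p a b : ℝ} [IsProbabilityMeasure (gig p a b)] : 0 < barK p a b := by
  by_contra! h
  have h0 : gig p a b = 0 := by
    have : (fun w => ENNReal.ofReal (gigPDF p a b w)) = 0 := by
      ext w
      refine ENNReal.ofReal_eq_zero.2 ?_
      unfold gigPDF
      split_ifs with hw
      · have : 1 / (2 * barK p a b) ≤ 0 := div_nonpos_of_nonneg_of_nonpos zero_le_one (by linarith)
        exact mul_nonpos_of_nonpos_of_nonneg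
          (mul_nonpos_of_nonpos_of_nonneg this (Real.rpow_nonneg hw.le _)) (Real.exp_pos _).le
      · exact le_rfl
    rw [gig, this, withDensity_zero]
  exact IsProbabilityMeasure.ne_zero (gig p a b) h0

theorem gigPDF_nonneg {p a b : ℝ} (h : 0 < barK p a b) (w : ℝ) : 0 ≤ gigPDF p a b w := by
  unfold gigPDF
  split_ifs with hw
  · positivity
  · exact le_rfl

/-- Fubini: for fixed w > 0 the event says that the maximum is at most (y - θw)/√w. -/
theorem measureReal_prod_eq_integral {ρ θ p a b : ℝ} (h₁ : -1 < ρ) (h₂ : ρ < 1)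
    [IsProbabilityMeasure (gig p a b)] (y : ℝ) :
    ((gig p a b).prod (bivariateNormal ρ)).real
        {q | θ * q.1 + Real.sqrt q.1 * max (q.2 0) (q.2 1) ≤ y} =
      ∫ w in Set.Ioi 0, gigPDF p a b w *
        cdf (skewNormal (skewParam ρ)) ((y - θ * w) / Real.sqrt w) := by
  have := isProbabilityMeasure_skewNormal h₁ h₂
  have hS : MeasurableSet {q : ℝ × EuclideanSpace ℝ (Fin 2) |
      θ * q.1 + Real.sqrt q.1 * max (q.2 0) (q.2 1) ≤ y} :=
    measurableSet_le (by fun_prop) (by fun_prop)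
  have hmax : Measurable fun z : EuclideanSpace ℝ (Fin 2) => max (z 0) (z 1) :=
    Measurable.max (by fun_prop) (by fun_prop)
  have hcdf : Measurable fun w =>
      cdf (skewNormal (skewParam ρ)) ((y - θ * w) / Real.sqrt w) :=
    (monotone_cdf _).measurable.comp (by fun_prop)
  have hpos := gigPDF_nonneg (barK_pos (p := p) (a := a) (b := b))
  rw [integral_eq_lintegral_of_nonneg_ae
    (ae_of_all _ fun w => mul_nonneg (hpos w) (cdf_nonneg _ _))
    ((measurable_gigPDF p a b).mul hcdf).aestronglyMeasurable, measureReal_def,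
    Measure.prod_apply hS]
  congr 1
  have hmp := measurable_measure_prodMk_left (ν := bivariateNormal ρ) hS
  rw [gig, lintegral_withDensity_eq_lintegral_mul _ (measurable_gigPDF p a b).ennreal_ofReal hmp,
    ← lintegral_indicator measurableSet_Ioi]
  refine lintegral_congr fun w => ?_
  rw [Pi.mul_apply]
  by_cases hw : 0 < w
  · rw [Set.indicator_of_mem (Set.mem_Ioi.2 hw), ENNReal.ofReal_mul (hpos w), ofReal_cdf,
      ← map_max_bivariateNormal h₁ h₂, Measure.map_apply hmax measurableSet_Iic]
    congr 2
    ext z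
    simp only [Set.mem_preimage, Set.mem_ofPred_eq, Set.mem_Iic]
    rw [le_div_iff₀ (Real.sqrt_pos.2 hw)]
    constructor <;> intro h <;> linarith
  · rw [Set.indicator_of_notMem (by simpa using hw), gigPDF, if_neg hw]
    simp

/-! ### Mills-type bounds for the normal and skew normal lower tails. -/

theorem hasDerivAt_cdf_withDensity {f : ℝ → ℝ} (hf : Continuous f) (h0 : ∀ x, 0 ≤ f x)
    [hμ : IsProbabilityMeasure (volume.withDensity fun x => ENNReal.ofReal (f x))] (x : ℝ) :
    HasDerivAt (cdf (volume.withDensity fun x => ENNReal.ofReal (f x))) (f x) x := by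
  have hint : Integrable f := by
    refine ⟨hf.aestronglyMeasurable, ?_⟩
    rw [hasFiniteIntegral_iff_ofReal (ae_of_all _ h0)]
    have h := hμ.measure_univ
    rw [withDensity_apply _ MeasurableSet.univ, Measure.restrict_univ] at h
    rw [h]; exact ENNReal.one_lt_top
  have hF : ∀ u, cdf (volume.withDensity fun x => ENNReal.ofReal (f x)) u =
      (∫ t in (0 : ℝ)..u, f t) + ∫ t in Set.Iic 0, f t := by
    intro u
    rw [cdf_eq_real, measureReal_def, withDensity_apply _ measurableSet_Iic,
      ← intervalIntegral.integral_Iic_sub_Iic hint.integrableOn hint.integrableOn,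
      integral_eq_lintegral_of_nonneg_ae (f := f) (μ := volume.restrict (Set.Iic u))
        (ae_of_all _ h0) hf.aestronglyMeasurable]
    ring
  rw [funext hF]
  exact (intervalIntegral.integral_hasDerivAt_right (hf.intervalIntegrable _ _)
    hf.stronglyMeasurable.stronglyMeasurableAtFilter hf.continuousAt).add_const _

theorem continuous_gaussianPDFReal : Continuous (gaussianPDFReal 0 1) := by
  rw [gaussianPDFReal_def]; fun_prop

theorem hasDerivAt_cdf_gaussian (x : ℝ) :
    HasDerivAt (cdf (gaussianReal 0 1)) (gaussianPDFReal 0 1 x) x := by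
  have h : gaussianReal 0 1 = volume.withDensity fun x => ENNReal.ofReal (gaussianPDFReal 0 1 x) :=
    gaussianReal_of_var_ne_zero 0 one_ne_zero
  have : IsProbabilityMeasure
      (volume.withDensity fun x => ENNReal.ofReal (gaussianPDFReal 0 1 x)) := h ▸ inferInstance
  rw [h]
  exact hasDerivAt_cdf_withDensity continuous_gaussianPDFReal (gaussianPDFReal_nonneg 0 1) x

theorem hasDerivAt_cdf_skewNormal (α : ℝ) [hμ : IsProbabilityMeasure (skewNormal α)] (x : ℝ) :
    HasDerivAt (cdf (skewNormal α))
      (2 * gaussianPDFReal 0 1 x * cdf (gaussianReal 0 1) (α * x)) x := by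
  have hc : Continuous (cdf (gaussianReal 0 1)) :=
    continuous_iff_continuousAt.2 fun x => (hasDerivAt_cdf_gaussian x).continuousAt
  unfold skewNormal at hμ ⊢
  exact hasDerivAt_cdf_withDensity
    (f := fun x => 2 * gaussianPDFReal 0 1 x * cdf (gaussianReal 0 1) (α * x))
    ((continuous_gaussianPDFReal.const_mul 2).mul (hc.comp (continuous_const_mul α)))
    (fun x => mul_nonneg (mul_nonneg zero_le_two (gaussianPDFReal_nonneg _ _ _)) (cdf_nonneg _ _)) x

/-- A function on `(0, ∞)` with nonpositive derivative and limit `0` is nonnegative. -/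
theorem nonneg_of_deriv_nonpos_of_tendsto {f f' : ℝ → ℝ}
    (hf : ∀ x, 0 < x → HasDerivAt f (f' x) x) (hf' : ∀ x, 0 < x → f' x ≤ 0)
    (hl : Tendsto f atTop (𝓝 0)) {x : ℝ} (hx : 0 < x) : 0 ≤ f x := by
  have ha : AntitoneOn f (Set.Ici x) := by
    refine antitoneOn_of_deriv_nonpos (convex_Ici x)
      (fun u hu => (hf u (hx.trans_le hu)).continuousAt.continuousWithinAt) ?_ ?_
    · intro u hu
      rw [interior_Ici] at hu
      exact (hf u (hx.trans hu)).differentiableAt.differentiableWithinAt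
    · intro u hu
      rw [interior_Ici] at hu
      rw [(hf u (hx.trans hu)).deriv]
      exact hf' u (hx.trans hu)
  refine le_of_tendsto hl ?_
  filter_upwards [eventually_ge_atTop x] with u hu
  exact ha Set.self_mem_Ici hu hu

theorem tendsto_exp_neg_sq_div {c k : ℝ} (hc : 0 ≤ c) {n : ℕ} (hn : n ≠ 0) :
    Tendsto (fun x : ℝ => k * Real.exp (-(c * x ^ 2 / 2)) / x ^ n) atTop (𝓝 0) := by
  have h1 : Tendsto (fun x : ℝ => |k| / x ^ n) atTop (𝓝 0) :=
    tendsto_const_nhds.div_atTop (tendsto_pow_atTop hn)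
  refine squeeze_zero_norm' ?_ h1
  filter_upwards [eventually_gt_atTop 0] with x hx
  rw [Real.norm_eq_abs, abs_div, abs_mul, abs_of_pos (pow_pos hx n), Real.abs_exp]
  gcongr
  have : Real.exp (-(c * x ^ 2 / 2)) ≤ 1 := Real.exp_le_one_iff.2 (by
    have : 0 ≤ c * x ^ 2 / 2 := by positivity
    linarith)
  nlinarith [abs_nonneg k]

/-- Every comparison function for the two tails is a combination of these, so the tail bounds reduce
to derivative comparisons with limit 0 at infinity. -/
theorem hasDerivAt_exp_neg_sq_div (c k : ℝ) (n : ℕ) {x : ℝ} (hx : 0 < x) :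
    HasDerivAt (fun x : ℝ => k * Real.exp (-(c * x ^ 2 / 2)) / x ^ n)
      (-(k * Real.exp (-(c * x ^ 2 / 2)) * (c * x / x ^ n + n / x ^ (n + 1)))) x := by
  have h1 : HasDerivAt (fun x : ℝ => -(c * x ^ 2 / 2)) (-(c * x)) x := by
    have := (((hasDerivAt_pow 2 x).const_mul c).div_const 2).neg
    refine this.congr_deriv ?_
    norm_num; ring
  have h2 := ((h1.exp.const_mul k).div (hasDerivAt_pow n x) (pow_ne_zero n hx.ne'))
  refine h2.congr_deriv ?_
  rcases n with _ | n
  · simp; ring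
  · have := hx.ne'
    simp only [Nat.add_sub_cancel]
    field_simp
    ring

theorem gaussianPDFReal_std (x : ℝ) :
    gaussianPDFReal 0 1 x = (Real.sqrt (2 * Real.pi))⁻¹ * Real.exp (-(1 * x ^ 2 / 2)) := by
  simp [gaussianPDFReal, neg_div]

theorem cdf_gaussian_neg_le {x : ℝ} (hx : 0 < x) :
    cdf (gaussianReal 0 1) (-x) ≤ gaussianPDFReal 0 1 x / x := by
  set k := (Real.sqrt (2 * Real.pi))⁻¹ with hk
  have hk0 : 0 < k := by positivity
  have key := nonneg_of_deriv_nonpos_of_tendsto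
    (f := fun x => k * Real.exp (-(1 * x ^ 2 / 2)) / x ^ 1 - cdf (gaussianReal 0 1) (-x))
    (fun u hu => (hasDerivAt_exp_neg_sq_div 1 k 1 hu).sub
      ((hasDerivAt_cdf_gaussian (-u)).comp u (hasDerivAt_neg u))) ?_ ?_ hx
  · rw [gaussianPDFReal_std, ← hk]
    simp only [pow_one] at key
    linarith
  · intro u hu
    rw [gaussianPDFReal_std, neg_sq, ← hk]
    have e : -(k * Real.exp (-(1 * u ^ 2 / 2)) * (1 * u / u ^ 1 + (1 : ℕ) / u ^ (1 + 1))) -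
        k * Real.exp (-(1 * u ^ 2 / 2)) * -1 = -(k * Real.exp (-(1 * u ^ 2 / 2)) / u ^ 2) := by
      have := hu.ne'
      push_cast; field_simp; ring
    rw [e]
    have : 0 ≤ k * Real.exp (-(1 * u ^ 2 / 2)) / u ^ 2 := by positivity
    linarith
  · simpa using (tendsto_exp_neg_sq_div (k := k) zero_le_one one_ne_zero).sub
      ((tendsto_cdf_atBot (gaussianReal 0 1)).comp tendsto_neg_atTop_atBot)

/-- The difference of the two sides tends to 0 and its derivative is -3 n(x)/x⁴, where n is the
normal density. -/
theorem le_cdf_gaussian_neg {x : ℝ} (hx : 0 < x) :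
    gaussianPDFReal 0 1 x * (1 / x - 1 / x ^ 3) ≤ cdf (gaussianReal 0 1) (-x) := by
  set k := (Real.sqrt (2 * Real.pi))⁻¹ with hk
  have hk0 : 0 < k := by positivity
  have key := nonneg_of_deriv_nonpos_of_tendsto
    (f := fun x => cdf (gaussianReal 0 1) (-x) - (k * Real.exp (-(1 * x ^ 2 / 2)) / x ^ 1 -
      k * Real.exp (-(1 * x ^ 2 / 2)) / x ^ 3))
    (fun u hu => ((hasDerivAt_cdf_gaussian (-u)).comp u (hasDerivAt_neg u)).sub
      ((hasDerivAt_exp_neg_sq_div 1 k 1 hu).sub (hasDerivAt_exp_neg_sq_div 1 k 3 hu))) ?_ ?_ hx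
  · rw [gaussianPDFReal_std, ← hk]
    have e : k * Real.exp (-(1 * x ^ 2 / 2)) * (1 / x - 1 / x ^ 3) =
      k * Real.exp (-(1 * x ^ 2 / 2)) / x ^ 1 - k * Real.exp (-(1 * x ^ 2 / 2)) / x ^ 3 := by
      ring
    rw [e]
    linarith
  · intro u hu
    rw [gaussianPDFReal_std, neg_sq, ← hk]
    refine le_of_eq_of_le (b := -(3 * k * Real.exp (-(1 * u ^ 2 / 2)) / u ^ 4)) ?_ ?_
    · have := hu.ne'
      push_cast; field_simp; ring
    · have : 0 ≤ 3 * k * Real.exp (-(1 * u ^ 2 / 2)) / u ^ 4 := by positivity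
      linarith
  · simpa using ((tendsto_cdf_atBot (gaussianReal 0 1)).comp tendsto_neg_atTop_atBot).sub
      ((tendsto_exp_neg_sq_div (k := k) zero_le_one one_ne_zero).sub
      (tendsto_exp_neg_sq_div (k := k) zero_le_one three_ne_zero))

theorem gaussianPDFReal_mul_gaussianPDFReal (α x : ℝ) :
    2 * gaussianPDFReal 0 1 x * gaussianPDFReal 0 1 (α * x) =
      Real.pi⁻¹ * Real.exp (-((1 + α ^ 2) * x ^ 2 / 2)) := by
  have hs : (Real.sqrt (2 * Real.pi))⁻¹ * (Real.sqrt (2 * Real.pi))⁻¹ = (2 * Real.pi)⁻¹ := by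
    rw [← mul_inv, Real.mul_self_sqrt (by positivity)]
  have he : Real.exp (-(1 * x ^ 2 / 2)) * Real.exp (-(1 * (α * x) ^ 2 / 2)) =
      Real.exp (-((1 + α ^ 2) * x ^ 2 / 2)) := by
    rw [← Real.exp_add]; congr 1; ring
  rw [gaussianPDFReal_std, gaussianPDFReal_std, ← he]
  have := Real.pi_pos.ne'
  calc _ = 2 * ((Real.sqrt (2 * Real.pi))⁻¹ * (Real.sqrt (2 * Real.pi))⁻¹) *
        (Real.exp (-(1 * x ^ 2 / 2)) * Real.exp (-(1 * (α * x) ^ 2 / 2))) := by ring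
    _ = _ := by rw [hs]; field_simp

/-- The leading coefficient of the lower tail of the skew normal law. -/
def skewTailCoef (α : ℝ) : ℝ := 1 / (Real.pi * α * (1 + α ^ 2))

/-- The coefficient A satisfies A(1+α²) = 1/(πα), so the leading term of the derivative of the bound
matches 2 n(x) N(-αx) after the normal Mills bound; what remains has a favourable sign. -/
theorem cdf_skewNormal_neg_le {α : ℝ} (hα : 0 < α) [IsProbabilityMeasure (skewNormal α)]
    {x : ℝ} (hx : 0 < x) :
    cdf (skewNormal α) (-x) ≤
      skewTailCoef α * Real.exp (-((1 + α ^ 2) * x ^ 2 / 2)) / x ^ 2 := by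
  have key := nonneg_of_deriv_nonpos_of_tendsto
    (f := fun x => skewTailCoef α * Real.exp (-((1 + α ^ 2) * x ^ 2 / 2)) / x ^ 2 -
      cdf (skewNormal α) (-x))
    (fun u hu => (hasDerivAt_exp_neg_sq_div (1 + α ^ 2) (skewTailCoef α) 2 hu).sub
      ((hasDerivAt_cdf_skewNormal α (-u)).comp u (hasDerivAt_neg u))) ?_ ?_ hx
  · linarith
  · intro u hu
    have hb := cdf_gaussian_neg_le (mul_pos hα hu)
    have hn : gaussianPDFReal 0 1 (-u) = gaussianPDFReal 0 1 u := by
      rw [gaussianPDFReal_std, gaussianPDFReal_std, neg_sq]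
    have h2 := gaussianPDFReal_mul_gaussianPDFReal α u
    have h3 : 2 * gaussianPDFReal 0 1 u * cdf (gaussianReal 0 1) (-(α * u)) ≤
        Real.pi⁻¹ * Real.exp (-((1 + α ^ 2) * u ^ 2 / 2)) / (α * u) := by
      rw [← h2, mul_div_assoc]
      exact mul_le_mul_of_nonneg_left hb
        (mul_nonneg zero_le_two (gaussianPDFReal_nonneg _ _ _))
    rw [hn, mul_neg α u]
    set E := Real.exp (-((1 + α ^ 2) * u ^ 2 / 2))
    have hE : 0 < E := Real.exp_pos _
    have e : skewTailCoef α * E * ((1 + α ^ 2) * u / u ^ 2 + (2 : ℕ) / u ^ (2 + 1)) =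
        Real.pi⁻¹ * E / (α * u) + 2 * skewTailCoef α * E / u ^ 3 := by
      have := Real.pi_pos.ne'
      have := hu.ne'
      have := hα.ne'
      have : 1 + α ^ 2 ≠ 0 := by positivity
      unfold skewTailCoef
      push_cast; field_simp
    have : 0 ≤ 2 * skewTailCoef α * E / u ^ 3 := by unfold skewTailCoef; positivity
    linarith
  · simpa using (tendsto_exp_neg_sq_div (k := skewTailCoef α) (by positivity : 0 ≤ 1 + α ^ 2)
      two_ne_zero).sub ((tendsto_cdf_atBot (skewNormal α)).comp tendsto_neg_atTop_atBot)

theorem le_cdf_skewNormal_neg {α : ℝ} (hα : 0 < α) [IsProbabilityMeasure (skewNormal α)] :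
    ∃ B : ℝ, 0 < B ∧ ∀ x, 0 < x →
      skewTailCoef α * Real.exp (-((1 + α ^ 2) * x ^ 2 / 2)) / x ^ 2 -
        B * Real.exp (-((1 + α ^ 2) * x ^ 2 / 2)) / x ^ 4 ≤ cdf (skewNormal α) (-x) := by
  have hA : 0 < skewTailCoef α := by unfold skewTailCoef; positivity
  have hpi := Real.pi_pos
  -- B is chosen so that B(1+α²) cancels all terms of order u⁻³ in the derivative, leaving only
  -- 4BE/u⁵.
  refine ⟨(1 / (Real.pi * α ^ 3) + 2 * skewTailCoef α) / (1 + α ^ 2), by positivity,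
    fun x hx => ?_⟩
  set B := (1 / (Real.pi * α ^ 3) + 2 * skewTailCoef α) / (1 + α ^ 2) with hB
  have hB0 : 0 < B := by positivity
  have key := nonneg_of_deriv_nonpos_of_tendsto
    (f := fun x => cdf (skewNormal α) (-x) -
      (skewTailCoef α * Real.exp (-((1 + α ^ 2) * x ^ 2 / 2)) / x ^ 2 -
        B * Real.exp (-((1 + α ^ 2) * x ^ 2 / 2)) / x ^ 4))
    (fun u hu => ((hasDerivAt_cdf_skewNormal α (-u)).comp u (hasDerivAt_neg u)).sub
      ((hasDerivAt_exp_neg_sq_div (1 + α ^ 2) (skewTailCoef α) 2 hu).sub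
      (hasDerivAt_exp_neg_sq_div (1 + α ^ 2) B 4 hu))) ?_ ?_ hx
  · linarith
  · intro u hu
    have hb := le_cdf_gaussian_neg (mul_pos hα hu)
    have hn : gaussianPDFReal 0 1 (-u) = gaussianPDFReal 0 1 u := by
      rw [gaussianPDFReal_std, gaussianPDFReal_std, neg_sq]
    have h2 := gaussianPDFReal_mul_gaussianPDFReal α u
    have h3 : Real.pi⁻¹ * Real.exp (-((1 + α ^ 2) * u ^ 2 / 2)) *
        (1 / (α * u) - 1 / (α * u) ^ 3) ≤
        2 * gaussianPDFReal 0 1 u * cdf (gaussianReal 0 1) (-(α * u)) := by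
      rw [← h2, mul_assoc (2 * gaussianPDFReal 0 1 u)]
      exact mul_le_mul_of_nonneg_left hb
        (mul_nonneg zero_le_two (gaussianPDFReal_nonneg _ _ _))
    rw [hn, mul_neg α u]
    set E := Real.exp (-((1 + α ^ 2) * u ^ 2 / 2))
    have hE : 0 < E := Real.exp_pos _
    have e : skewTailCoef α * E * ((1 + α ^ 2) * u / u ^ 2 + (2 : ℕ) / u ^ (2 + 1)) -
        B * E * ((1 + α ^ 2) * u / u ^ 4 + (4 : ℕ) / u ^ (4 + 1)) =
        Real.pi⁻¹ * E * (1 / (α * u) - 1 / (α * u) ^ 3) - 4 * B * E / u ^ 5 := by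
      have := hpi.ne'
      have := hu.ne'
      have := hα.ne'
      have : 1 + α ^ 2 ≠ 0 := by positivity
      rw [hB]
      unfold skewTailCoef
      push_cast; field_simp; ring
    have : 0 ≤ 4 * B * E / u ^ 5 := by positivity
    linarith
  · simpa using ((tendsto_cdf_atBot (skewNormal α)).comp tendsto_neg_atTop_atBot).sub
      ((tendsto_exp_neg_sq_div (k := skewTailCoef α) (by positivity : 0 ≤ 1 + α ^ 2)
      two_ne_zero).sub (tendsto_exp_neg_sq_div (k := B) (by positivity : 0 ≤ 1 + α ^ 2)
      four_ne_zero))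

/-- The lower tail is dominated by the Gaussian exponential uniformly on the negative axis. -/
theorem cdf_skewNormal_neg_le_exp {α : ℝ} (hα : 0 < α) [IsProbabilityMeasure (skewNormal α)] :
    ∃ C : ℝ, 0 < C ∧ ∀ x, 0 ≤ x →
      cdf (skewNormal α) (-x) ≤ C * Real.exp (-((1 + α ^ 2) * x ^ 2 / 2)) := by
  have hA : 0 < skewTailCoef α := by unfold skewTailCoef; positivity
  -- The second summand covers x ≤ 1 through the trivial bound 1; the first covers x > 1, where 1/x²
  -- ≤ 1.
  refine ⟨skewTailCoef α + Real.exp ((1 + α ^ 2) / 2), by positivity, fun x hx => ?_⟩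
  rcases le_or_gt x 1 with h | h
  · refine (cdf_le_one _ _).trans ?_
    have h1 : 1 ≤ Real.exp ((1 + α ^ 2) / 2) * Real.exp (-((1 + α ^ 2) * x ^ 2 / 2)) := by
      rw [← Real.exp_add, Real.one_le_exp_iff]
      have : x ^ 2 ≤ 1 := by nlinarith
      nlinarith [sq_nonneg α]
    nlinarith [mul_pos hA (Real.exp_pos (-((1 + α ^ 2) * x ^ 2 / 2)))]
  · refine (cdf_skewNormal_neg_le hα (by linarith)).trans ?_
    have h2 : skewTailCoef α * Real.exp (-((1 + α ^ 2) * x ^ 2 / 2)) / x ^ 2 ≤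
        skewTailCoef α * Real.exp (-((1 + α ^ 2) * x ^ 2 / 2)) :=
      div_le_self (by positivity) (by nlinarith)
    nlinarith [mul_pos (Real.exp_pos ((1 + α ^ 2) / 2))
      (Real.exp_pos (-((1 + α ^ 2) * x ^ 2 / 2)))]

/-! ### Laplace's method for the phase cosh x - 1. -/

theorem one_add_sq_div_two_le_cosh (x : ℝ) : 1 + x ^ 2 / 2 ≤ Real.cosh x := by
  have h : |x| / 2 ≤ Real.sinh (|x| / 2) := Real.self_le_sinh_iff.2 (by positivity)
  have h2 : Real.cosh x = 1 + 2 * Real.sinh (|x| / 2) ^ 2 := by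
    rw [← Real.cosh_abs, show |x| = 2 * (|x| / 2) by ring, Real.cosh_two_mul, Real.cosh_sq]
    ring_nf
  have h3 : (|x| / 2) ^ 2 ≤ Real.sinh (|x| / 2) ^ 2 := by
    gcongr
  rw [h2]
  rw [div_pow, sq_abs] at h3
  linarith

theorem cosh_le_one_add_sq_add_pow_four (x : ℝ) :
    Real.cosh x ≤ 1 + x ^ 2 / 2 + x ^ 4 / 4 * Real.exp (x ^ 2 / 2) := by
  refine (Real.cosh_le_exp_half_sq x).trans ?_
  set y := x ^ 2 / 2 with hy
  have hy0 : 0 ≤ y := by positivity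
  have h1 : 1 - y ≤ Real.exp (-y) := by linarith [Real.add_one_le_exp (-y)]
  have h2 : Real.exp (-y) * Real.exp y = 1 := by rw [← Real.exp_add]; simp
  have h3 : x ^ 4 / 4 = y ^ 2 := by rw [hy]; ring
  rw [h3]
  -- Multiplying by eʸ gives eʸ ≤ 1 + y + y² eʸ.
  have h4 : (1 - y) * (1 + y) ≤ Real.exp (-y) * (1 + y) :=
    mul_le_mul_of_nonneg_right h1 (by linarith)
  nlinarith [Real.exp_pos y]

theorem abs_exp_neg_sub_exp_neg_le {A B : ℝ} (h : A ≤ B) :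
    |Real.exp (-B) - Real.exp (-A)| ≤ (B - A) * Real.exp (-A) := by
  rw [abs_sub_comm, abs_of_nonneg (by simpa using h)]
  have h1 : Real.exp (-B) = Real.exp (-A) * Real.exp (-(B - A)) := by
    rw [← Real.exp_add]; congr 1; ring
  have h2 := Real.add_one_le_exp (-(B - A))
  nlinarith [Real.exp_pos (-A)]

theorem mul_exp_neg_le_one {y : ℝ} : y * Real.exp (-y) ≤ 1 := by
  have h2 : Real.exp (-y) * Real.exp y = 1 := by rw [← Real.exp_add]; simp
  nlinarith [Real.add_one_le_exp y, Real.exp_pos (-y)]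

theorem sq_mul_exp_neg_le_two {y : ℝ} (hy : 0 ≤ y) : y ^ 2 * Real.exp (-y) ≤ 2 := by
  have h2 : Real.exp (-y) * Real.exp y = 1 := by rw [← Real.exp_add]; simp
  nlinarith [Real.quadratic_le_exp_of_nonneg hy, Real.exp_pos (-y)]

/-- Half of the Gaussian decay absorbs the factor x². The gain 1/l becomes the 1/t of the error once
l is proportional to t; `pow_four_mul_exp_le` serves likewise for the quartic error of the phase. -/
theorem sq_mul_exp_le {l x : ℝ} (hl : 0 < l) :
    x ^ 2 * Real.exp (-(l * x ^ 2 / 2)) ≤ 4 / l * Real.exp (-(l / 4) * x ^ 2) := by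
  have h := mul_exp_neg_le_one (y := l / 4 * x ^ 2)
  have e : Real.exp (-(l * x ^ 2 / 2)) =
      Real.exp (-(l / 4 * x ^ 2)) * Real.exp (-(l / 4) * x ^ 2) := by
    rw [← Real.exp_add]; congr 1; ring
  rw [e, ← mul_assoc]
  refine mul_le_mul_of_nonneg_right ?_ (Real.exp_pos _).le
  rw [le_div_iff₀ hl]
  linarith

theorem pow_four_mul_exp_le {l x : ℝ} (hl : 0 < l) :
    l * x ^ 4 * Real.exp (-(l * x ^ 2 / 2)) ≤ 32 / l * Real.exp (-(l / 4) * x ^ 2) := by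
  have h := sq_mul_exp_neg_le_two (y := l / 4 * x ^ 2) (by positivity)
  have e : Real.exp (-(l * x ^ 2 / 2)) =
      Real.exp (-(l / 4 * x ^ 2)) * Real.exp (-(l / 4) * x ^ 2) := by
    rw [← Real.exp_add]; congr 1; ring
  rw [e, ← mul_assoc]
  refine mul_le_mul_of_nonneg_right ?_ (Real.exp_pos _).le
  rw [le_div_iff₀ hl]
  linarith

theorem exp_neg_cosh_le {l : ℝ} (hl : 0 < l) (x : ℝ) :
    Real.exp (-(l * (Real.cosh x - 1))) ≤ Real.exp (-(l * x ^ 2 / 2)) := by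
  rw [Real.exp_le_exp]
  nlinarith [one_add_sq_div_two_le_cosh x]

/-- The integrand is odd. This removes the linear term of the amplitude, whose absolute value would
only give a relative error of order t^(-1/2). -/
theorem integral_mul_exp_neg_cosh (l η : ℝ) :
    ∫ x in Set.Icc (-η) η, x * Real.exp (-(l * (Real.cosh x - 1))) = 0 := by
  set f : ℝ → ℝ := (Set.Icc (-η) η).indicator fun x => x * Real.exp (-(l * (Real.cosh x - 1)))
    with hf
  have hodd : ∀ x, f (-x) = -f x := by
    intro x
    have : -x ∈ Set.Icc (-η) η ↔ x ∈ Set.Icc (-η) η := by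
      simp only [Set.mem_Icc]
      constructor <;> rintro ⟨h1, h2⟩ <;> constructor <;> linarith
    by_cases hx : x ∈ Set.Icc (-η) η
    · rw [hf, Set.indicator_of_mem (this.2 hx), Set.indicator_of_mem hx, Real.cosh_neg]
      ring
    · rw [hf, Set.indicator_of_notMem (mt this.1 hx), Set.indicator_of_notMem hx, neg_zero]
  rw [← integral_indicator measurableSet_Icc, ← hf]
  have h1 : ∫ x, f (-x) = ∫ x, f x := integral_neg_eq_self f volume
  simp_rw [hodd] at h1
  rw [integral_neg] at h1
  linarith

/-- Laplace's method for the phase `cosh x - 1` at an interior point, with relative error of the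
order of the inverse of the large parameter. -/
theorem laplace_cosh {l η g₀ g₁ C : ℝ} (hl : 0 < l) (hη : 0 < η) {G : ℝ → ℝ → ℝ}
    (hC : 0 ≤ C)
    (hG : ∀ t, 1 ≤ t → ∀ x ∈ Set.Icc (-η) η, |G t x - g₀ - g₁ * x| ≤ C * (x ^ 2 + 1 / t))
    (hm : ∀ t, Measurable (G t)) :
    ∃ D : ℝ, ∀ t, 1 ≤ t →
      |(∫ x in Set.Icc (-η) η, G t x * Real.exp (-(l * t * (Real.cosh x - 1)))) -
        g₀ * Real.sqrt (2 * Real.pi / (l * t))| ≤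
        D / t * Real.sqrt (2 * Real.pi / (l * t)) := by
  set M := Real.exp (η ^ 2 / 2) with hM
  set D₁ := C * (4 / l) + C + |g₀| * (M * (8 / l)) with hD₁
  set D₂ := |g₀| * (4 / l) / η ^ 2 with hD₂
  have hD₁0 : 0 ≤ D₁ := by positivity
  have hD₂0 : 0 ≤ D₂ := by positivity
  -- D₁ bounds the errors inside the interval (amplitude remainder and replacing cosh x - 1 by
  -- x²/2), D₂ the Gaussian mass outside. The √2 pays for the weaker Gaussian exp(-kx²/4).
  refine ⟨(D₁ + D₂) * Real.sqrt 2, fun t ht => ?_⟩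
  have ht0 : 0 < t := by linarith
  set k := l * t with hk
  have hk0 : 0 < k := by positivity
  set E : ℝ → ℝ := fun x => Real.exp (-(k * (Real.cosh x - 1))) with hE
  set S := Set.Icc (-η) η with hS
  have hEc : Continuous E := by fun_prop
  have hGi : IntegrableOn (fun x => G t x * E x) S := by
    refine Measure.integrableOn_of_bounded (M := |g₀| + |g₁| * η + C * (η ^ 2 + 1))
      measure_Icc_lt_top.ne ((hm t).mul hEc.measurable).aestronglyMeasurable ?_
    filter_upwards [ae_restrict_mem measurableSet_Icc] with x hx
    have h1 := hG t ht x hx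
    have hxη : |x| ≤ η := abs_le.2 hx
    have h2 : E x ≤ 1 := Real.exp_le_one_iff.2 (by nlinarith [Real.one_le_cosh x])
    have h3 : 0 < E x := Real.exp_pos _
    have h4 : |G t x| ≤ |g₀| + |g₁| * η + C * (η ^ 2 + 1) := by
      have h5 : x ^ 2 ≤ η ^ 2 := by rw [← sq_abs]; gcongr
      have h6 : 1 / t ≤ 1 := by rw [div_le_one ht0]; exact ht
      have h7 : C * (x ^ 2 + 1 / t) ≤ C * (η ^ 2 + 1) := by gcongr
      have h8 : |g₁ * x| ≤ |g₁| * η := by rw [abs_mul]; gcongr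
      have h9 : |G t x| ≤ |G t x - g₀ - g₁ * x| + |g₀| + |g₁ * x| := by
        calc |G t x| = |(G t x - g₀ - g₁ * x) + g₀ + g₁ * x| := by ring_nf
          _ ≤ _ := abs_add_three _ _ _
      linarith
    rw [Real.norm_eq_abs, abs_mul, abs_of_pos h3]
    nlinarith [abs_nonneg (G t x)]
  have hxi : IntegrableOn (fun x => g₁ * (x * E x)) S :=
    (by fun_prop : Continuous fun x => g₁ * (x * E x)).continuousOn.integrableOn_Icc
  have hgi : Integrable fun x : ℝ => g₀ * Real.exp (-(k / 2) * x ^ 2) :=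
    (integrable_exp_neg_mul_sq (by positivity)).const_mul _
  -- Subtracting the odd term on S and the Gaussian on all of ℝ leaves one function, to be bounded
  -- pointwise by an integrable Gaussian with factor 1/t.
  set F : ℝ → ℝ := fun x => S.indicator (fun x => G t x * E x - g₁ * (x * E x)) x -
    g₀ * Real.exp (-(k / 2) * x ^ 2) with hF
  have hint : ∫ x, F x = (∫ x in S, G t x * E x) - g₀ * Real.sqrt (2 * Real.pi / k) := by
    have hi : Integrable (S.indicator fun x => G t x * E x - g₁ * (x * E x)) :=
      IntegrableOn.integrable_indicator (hGi.sub hxi) measurableSet_Icc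
    rw [hF, integral_sub hi hgi,
      integral_indicator measurableSet_Icc, integral_sub hGi hxi, integral_const_mul,
      integral_mul_exp_neg_cosh, integral_const_mul, integral_gaussian]
    rw [mul_zero, sub_zero]
    congr 3
    field_simp
  rw [← hint]
  have hbound : ∀ x, ‖F x‖ ≤ (D₁ + D₂) / t * Real.exp (-(k / 4) * x ^ 2) := by
    intro x
    set q := Real.exp (-(k / 4) * x ^ 2) with hq
    have hq0 : 0 < q := Real.exp_pos _
    set N := Real.exp (-(k * x ^ 2 / 2)) with hN
    have hNe : Real.exp (-(k / 2) * x ^ 2) = N := by rw [hN]; congr 1; ring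
    have hsq : x ^ 2 * N ≤ 4 / k * q := sq_mul_exp_le hk0
    have hN0 : 0 < N := Real.exp_pos _
    have hk4 : 4 / k = (4 / l) / t := by rw [hk]; field_simp
    by_cases hx : x ∈ S
    · rw [hF]
      simp only [Set.indicator_of_mem hx, hNe]
      have hEN : E x ≤ N := exp_neg_cosh_le hk0 x
      have hE0 : 0 < E x := Real.exp_pos _
      have hNq : N ≤ q := by
        rw [hN, hq, Real.exp_le_exp]
        nlinarith [mul_nonneg hk0.le (sq_nonneg x)]
      have h1 := hG t ht x hx
      have h2 : |(G t x - g₀ - g₁ * x) * E x| ≤ (C * (4 / l) + C) / t * q := by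
        rw [abs_mul, abs_of_pos hE0]
        calc _ ≤ C * (x ^ 2 + 1 / t) * N := by gcongr
          _ = C * (x ^ 2 * N) + C / t * N := by ring
          _ ≤ C * (4 / k * q) + C / t * q := by gcongr
          _ = _ := by rw [hk4]; ring
      have hxη : |x| ≤ η := abs_le.2 hx
      have h3 : |E x - N| ≤ M * (8 / l) / t * q := by
        have hA : k * x ^ 2 / 2 ≤ k * (Real.cosh x - 1) := by
          nlinarith [one_add_sq_div_two_le_cosh x]
        refine (abs_exp_neg_sub_exp_neg_le hA).trans ?_
        have hB : k * (Real.cosh x - 1) - k * x ^ 2 / 2 ≤ k * x ^ 4 * (M / 4) := by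
          have h4 := cosh_le_one_add_sq_add_pow_four x
          have h5 : Real.exp (x ^ 2 / 2) ≤ M := by
            rw [hM, Real.exp_le_exp, ← sq_abs x]; gcongr
          have h6 : x ^ 4 / 4 * Real.exp (x ^ 2 / 2) ≤ x ^ 4 / 4 * M := by gcongr
          have h7 : Real.cosh x - 1 - x ^ 2 / 2 ≤ x ^ 4 / 4 * M := by linarith
          have h8 := mul_le_mul_of_nonneg_left h7 hk0.le
          linarith
        calc _ ≤ k * x ^ 4 * (M / 4) * N := by rw [← hN]; gcongr
          _ = M / 4 * (k * x ^ 4 * N) := by ring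
          _ ≤ M / 4 * (32 / k * q) := by
            have := pow_four_mul_exp_le (x := x) hk0
            gcongr
          _ = _ := by rw [hk]; field_simp; ring
      rw [Real.norm_eq_abs]
      calc _ = |(G t x - g₀ - g₁ * x) * E x + g₀ * (E x - N)| := by congr 1; ring
        _ ≤ |(G t x - g₀ - g₁ * x) * E x| + |g₀| * |E x - N| := by
          rw [← abs_mul]; exact abs_add_le _ _
        _ ≤ (C * (4 / l) + C) / t * q + |g₀| * (M * (8 / l) / t * q) := by gcongr
        _ = D₁ / t * q := by rw [hD₁]; ring
        _ ≤ _ := by gcongr; linarith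
    · rw [hF]
      simp only [Set.indicator_of_notMem hx, hNe, zero_sub, norm_neg, norm_mul, Real.norm_eq_abs,
        abs_of_pos hN0]
      have hxη : η < |x| := by
        by_contra! h
        exact hx (abs_le.1 h)
      have h1 : η ^ 2 ≤ x ^ 2 := by rw [← sq_abs x]; gcongr
      have h2 : N ≤ (4 / l) / η ^ 2 / t * q := by
        have h3 : η ^ 2 * N ≤ (4 / l) / t * q := by
          rw [← hk4]; exact (mul_le_mul_of_nonneg_right h1 hN0.le).trans hsq
        have hη2 : 0 < η ^ 2 := by positivity
        calc N = (η ^ 2 * N) / η ^ 2 := by field_simp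
          _ ≤ ((4 / l) / t * q) / η ^ 2 := by gcongr
          _ = _ := by ring
      calc |g₀| * N ≤ |g₀| * ((4 / l) / η ^ 2 / t * q) := by gcongr
        _ = D₂ / t * q := by rw [hD₂]; ring
        _ ≤ _ := by gcongr; linarith
  have hqi : Integrable fun x : ℝ => (D₁ + D₂) / t * Real.exp (-(k / 4) * x ^ 2) :=
    (integrable_exp_neg_mul_sq (by positivity)).const_mul _
  have := norm_integral_le_of_norm_le hqi (ae_of_all _ hbound)
  rw [integral_const_mul, integral_gaussian] at this
  rw [← Real.norm_eq_abs]
  refine this.trans_eq ?_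
  rw [show Real.pi / (k / 4) = 2 * (2 * Real.pi / k) by field_simp; ring,
    Real.sqrt_mul zero_le_two]
  ring

/-- A twice continuously differentiable function has a first order expansion with quadratic error
near the origin. -/
theorem eventually_abs_sub_linear_le {g : ℝ → ℝ} (hg : ContDiffAt ℝ 2 g 0) :
    ∃ C : ℝ, 0 ≤ C ∧ ∃ η : ℝ, 0 < η ∧ ∀ x, |x| ≤ η →
      |g x - g 0 - deriv g 0 * x| ≤ C * x ^ 2 := by
  have hd : DifferentiableAt ℝ (deriv g) 0 := by
    have h1 : ContDiffAt ℝ 1 (deriv g) 0 := by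
      have h2 : ContDiffAt ℝ 1 (fun x => fderiv ℝ g x 1) 0 :=
        (hg.fderiv_right (m := 1) (by norm_num)).clm_apply contDiffAt_const
      simpa only [fderiv_apply_one_eq_deriv] using h2
    exact h1.differentiableAt one_ne_zero
  have hO := hd.hasDerivAt.isBigO_sub
  obtain ⟨C, hC0, hC⟩ := hO.exists_nonneg
  have hev : ∀ᶠ x in 𝓝 (0 : ℝ), DifferentiableAt ℝ g x :=
    (hg.eventually (by simp)).mono fun x hx => hx.differentiableAt two_ne_zero
  obtain ⟨η, hη, hball⟩ := Metric.eventually_nhds_iff_ball.1 (hev.and hC.bound)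
  refine ⟨C, hC0, η / 2, by positivity, fun x hx => ?_⟩
  have hsub : ∀ y ∈ Set.Icc (-|x|) |x|, y ∈ Metric.ball (0 : ℝ) η := by
    intro y hy
    rw [mem_ball_zero_iff, Real.norm_eq_abs]
    linarith [abs_le.2 hy]
  -- Mean value inequality for g(y) - g'(0)y, whose derivative is at most C|x| on [-|x|, |x|].
  have hmv := (convex_Icc (-|x|) |x|).norm_image_sub_le_of_norm_hasDerivWithin_le
    (f := fun y => g y - deriv g 0 * y) (f' := fun y => deriv g y - deriv g 0 * 1)
    (C := C * |x|) (x := 0) (y := x)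
    (fun y hy => ((hball y (hsub y hy)).1.hasDerivAt.sub
      ((hasDerivAt_id y).const_mul _)).hasDerivWithinAt)
    (fun y hy => by
      have := (hball y (hsub y hy)).2
      rw [mul_one]
      refine this.trans ?_
      rw [sub_zero, Real.norm_eq_abs]
      exact mul_le_mul_of_nonneg_left (abs_le.2 hy) hC0)
    ⟨by simp, by simp⟩ (abs_le.1 le_rfl)
  calc _ = ‖g x - deriv g 0 * x - (g 0 - deriv g 0 * 0)‖ := by rw [Real.norm_eq_abs]; ring_nf
    _ ≤ _ := hmv
    _ = C * x ^ 2 := by rw [sub_zero, Real.norm_eq_abs, mul_assoc, ← sq, sq_abs]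

/-! ### The phase and its saddle point. -/

theorem betaParam_sq (α θ b : ℝ) : betaParam α θ b ^ 2 = θ ^ 2 * (1 + α ^ 2) + b ^ 2 :=
  Real.sq_sqrt (by positivity)

theorem betaParam_pos (α θ : ℝ) {b : ℝ} (hb : 0 < b) : 0 < betaParam α θ b :=
  Real.sqrt_pos.2 (by positivity)

/-- Strict because b > 0. It keeps the decay rate positive for negative θ and places the saddle
strictly inside 1 + θu > 0. -/
theorem abs_mul_sqrt_lt_betaParam (α θ : ℝ) {b : ℝ} (hb : 0 < b) :
    |θ| * Real.sqrt (1 + α ^ 2) < betaParam α θ b := by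
  refine lt_of_pow_lt_pow_left₀ 2 (betaParam_pos α θ hb).le ?_
  rw [mul_pow, sq_abs, Real.sq_sqrt (by positivity), betaParam_sq]
  nlinarith [sq_pos_of_pos hb]

theorem betaParam_add_pos (α θ : ℝ) {b : ℝ} (hb : 0 < b) :
    0 < betaParam α θ b + θ * Real.sqrt (1 + α ^ 2) := by
  have := abs_mul_sqrt_lt_betaParam α θ hb
  nlinarith [neg_abs_le θ, Real.sqrt_nonneg (1 + α ^ 2)]

theorem phiAlpha_add (α θ b : ℝ) :
    phiAlpha α θ b + θ = Real.sqrt (1 + α ^ 2) *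
      (betaParam α θ b + θ * Real.sqrt (1 + α ^ 2)) := by
  have h : Real.sqrt (1 + α ^ 2) ^ 2 = 1 + α ^ 2 := Real.sq_sqrt (by positivity)
  unfold phiAlpha
  linear_combination (-θ) * h

theorem phiAlpha_add_pos (α θ : ℝ) {b : ℝ} (hb : 0 < b) : 0 < phiAlpha α θ b + θ := by
  rw [phiAlpha_add]
  exact mul_pos (Real.sqrt_pos.2 (by positivity)) (betaParam_add_pos α θ hb)

theorem tailConst_pos {α θ p a b : ℝ} (hα : 0 < α) (hb : 0 < b) (hK : 0 < barK p a b) :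
    0 < tailConst α θ p a b := by
  have h1 := betaParam_pos α θ hb
  have h2 := betaParam_add_pos α θ hb
  have h3 := phiAlpha_add_pos α θ hb
  unfold tailConst thetaTildeZero
  positivity

/-- The location of the saddle point relative to the large parameter. -/
def saddle (α θ b : ℝ) : ℝ := Real.sqrt (1 + α ^ 2) / betaParam α θ b

theorem saddle_pos (α θ : ℝ) {b : ℝ} (hb : 0 < b) : 0 < saddle α θ b :=
  div_pos (Real.sqrt_pos.2 (by positivity)) (betaParam_pos α θ hb)

theorem one_add_mul_saddle_pos (α θ : ℝ) {b : ℝ} (hb : 0 < b) : 0 < 1 + θ * saddle α θ b := by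
  have h := betaParam_pos α θ hb
  have e : 1 + θ * saddle α θ b =
      (betaParam α θ b + θ * Real.sqrt (1 + α ^ 2)) / betaParam α θ b := by
    unfold saddle; field_simp
  rw [e]
  exact div_pos (betaParam_add_pos α θ hb) h

/-- With s² = 1+α², expanding and using β² = θ²s² + b² turns the phase into s²/(2u) + β²u/2 + θs².
At u = (s/β)eˣ the first two terms add up to sβ cosh x. -/
theorem phase_identity (α θ : ℝ) {b : ℝ} (hb : 0 < b) (x : ℝ) :
    (1 + α ^ 2) * ((1 + θ * (saddle α θ b * Real.exp x)) ^ 2 / (saddle α θ b * Real.exp x)) / 2 +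
      b ^ 2 * (saddle α θ b * Real.exp x) / 2 =
    phiAlpha α θ b + θ +
      Real.sqrt (1 + α ^ 2) * betaParam α θ b * (Real.cosh x - 1) := by
  have h0 := betaParam_pos α θ hb
  have hb2 := betaParam_sq α θ b
  have hs0 : 0 < Real.sqrt (1 + α ^ 2) := Real.sqrt_pos.2 (by positivity)
  have hs2 : Real.sqrt (1 + α ^ 2) ^ 2 = 1 + α ^ 2 := Real.sq_sqrt (by positivity)
  rw [phiAlpha_add, Real.cosh_eq, Real.exp_neg]
  unfold saddle
  set s := Real.sqrt (1 + α ^ 2)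
  set β := betaParam α θ b
  have hX := Real.exp_pos x
  set X := Real.exp x
  have hb' : b ^ 2 = β ^ 2 - θ ^ 2 * s ^ 2 := by rw [hs2]; linarith
  rw [← hs2, hb']
  field_simp
  ring

/-! ### Contribution near the saddle point. -/

/-- Uniform comparison of the exact skew normal tail with its leading term, in scaled
coordinates. -/
theorem scaled_tail_bound {α : ℝ} (θ p a : ℝ) (hα : 0 < α)
    [IsProbabilityMeasure (skewNormal α)] :
    ∃ B : ℝ, 0 < B ∧ ∀ t u : ℝ, 0 < t → 0 < u → 0 < 1 + θ * u →
      |t * u ^ p * Real.exp (-(a ^ 2 / (2 * (t * u)))) *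
        (Real.exp ((1 + α ^ 2) * (t * ((1 + θ * u) ^ 2 / u)) / 2) *
          cdf (skewNormal α) (-(Real.sqrt t * ((1 + θ * u) / Real.sqrt u)))) -
        skewTailCoef α * u ^ p * (u / (1 + θ * u) ^ 2)| ≤
      u ^ p * (B * (u / (1 + θ * u) ^ 2) ^ 2 +
        skewTailCoef α * (u / (1 + θ * u) ^ 2) * (a ^ 2 / (2 * u))) * (1 / t) := by
  obtain ⟨B, hB, hlow⟩ := le_cdf_skewNormal_neg hα
  refine ⟨B, hB, fun t u ht hu hθ => ?_⟩
  have hA : 0 < skewTailCoef α := by unfold skewTailCoef; positivity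
  have hv : 0 < Real.sqrt t * ((1 + θ * u) / Real.sqrt u) := by positivity
  have h1 := hlow _ hv
  have h2 := cdf_skewNormal_neg_le hα hv
  set v := Real.sqrt t * ((1 + θ * u) / Real.sqrt u) with hvdef
  set A := skewTailCoef α
  set H := cdf (skewNormal α) (-v)
  have hv2 : v ^ 2 = t * ((1 + θ * u) ^ 2 / u) := by
    rw [hvdef, mul_pow, div_pow, Real.sq_sqrt ht.le, Real.sq_sqrt hu.le]
  rw [← hv2]
  -- The squared argument of the tail is t/r, so the leading term A/v² times t is Ar, and the
  -- correction B/v⁴ times t is Br²/t.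
  set r := u / (1 + θ * u) ^ 2 with hr
  have hr0 : 0 < r := by positivity
  have hv2' : v ^ 2 = t / r := by rw [hv2, hr]; field_simp
  set e := Real.exp (-((1 + α ^ 2) * v ^ 2 / 2)) with he
  set f := Real.exp ((1 + α ^ 2) * v ^ 2 / 2) with hf
  have hfe : f * e = 1 := by rw [he, hf, ← Real.exp_add]; simp
  have hf0 : 0 < f := Real.exp_pos _
  have hv4 : v ^ 4 = t ^ 2 / r ^ 2 := by
    rw [show v ^ 4 = (v ^ 2) ^ 2 by ring, hv2']; ring
  have hup : t * (f * H) ≤ A * r := by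
    have h3 := mul_le_mul_of_nonneg_left h2 hf0.le
    have e1 : f * (A * e / v ^ 2) = A * r / t := by
      rw [hv2']; field_simp; linear_combination hfe
    rw [e1, le_div_iff₀ ht] at h3
    linarith
  have hlo : A * r - B * r ^ 2 * (1 / t) ≤ t * (f * H) := by
    have h3 := mul_le_mul_of_nonneg_left h1 hf0.le
    have e1 : f * (A * e / v ^ 2 - B * e / v ^ 4) = A * r / t - B * r ^ 2 / t ^ 2 := by
      rw [hv2', hv4]
      calc _ = (f * e) * (A / (t / r) - B / (t ^ 2 / r ^ 2)) := by ring
        _ = _ := by rw [hfe]; field_simp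
    rw [e1] at h3
    have h4 := mul_le_mul_of_nonneg_left h3 ht.le
    have e2 : t * (A * r / t - B * r ^ 2 / t ^ 2) = A * r - B * r ^ 2 * (1 / t) := by
      field_simp
    rwa [e2] at h4
  set q := Real.exp (-(a ^ 2 / (2 * (t * u)))) with hq
  have hq0 : 0 < q := Real.exp_pos _
  have hq1 : q ≤ 1 := Real.exp_le_one_iff.2 (by
    have : 0 ≤ a ^ 2 / (2 * (t * u)) := by positivity
    linarith)
  have hq2 : 1 - q ≤ a ^ 2 / (2 * u) * (1 / t) := by
    have := Real.add_one_le_exp (-(a ^ 2 / (2 * (t * u))))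
    have e1 : a ^ 2 / (2 * (t * u)) = a ^ 2 / (2 * u) * (1 / t) := by field_simp
    rw [← e1]; linarith
  have hH0 : 0 ≤ t * (f * H) := mul_nonneg ht.le (mul_nonneg hf0.le (cdf_nonneg _ _))
  have hup0 : 0 < u ^ p := Real.rpow_pos_of_pos hu p
  have e3 : t * u ^ p * q * (f * H) - A * u ^ p * r = u ^ p * (q * (t * (f * H)) - A * r) := by
    ring
  rw [e3, abs_mul, abs_of_pos hup0, mul_assoc]
  refine mul_le_mul_of_nonneg_left ?_ hup0.le
  have hAr : 0 < A * r := mul_pos hA hr0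
  have hc1 : 0 ≤ B * r ^ 2 * (1 / t) := by positivity
  have hc2 : 0 ≤ A * r * (a ^ 2 / (2 * u)) * (1 / t) := by positivity
  have hc3 : (1 - q) * (A * r) ≤ a ^ 2 / (2 * u) * (1 / t) * (A * r) := by gcongr
  rw [abs_le]
  constructor
  · have : q * (A * r - B * r ^ 2 * (1 / t)) ≤ q * (t * (f * H)) := by gcongr
    nlinarith
  · have : q * (t * (f * H)) ≤ 1 * (t * (f * H)) := by gcongr
    nlinarith

/-- The rescaled amplitude of the mixture integral near the saddle point. -/
def amplitude (α θ p a b t x : ℝ) : ℝ :=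
  t * (saddle α θ b * Real.exp x) ^ p *
    Real.exp (-(a ^ 2 / (2 * (t * (saddle α θ b * Real.exp x))))) *
    (Real.exp ((1 + α ^ 2) *
      (t * ((1 + θ * (saddle α θ b * Real.exp x)) ^ 2 / (saddle α θ b * Real.exp x))) / 2) *
    cdf (skewNormal α) (-(Real.sqrt t *
      ((1 + θ * (saddle α θ b * Real.exp x)) / Real.sqrt (saddle α θ b * Real.exp x)))))

/-- The value of the limiting amplitude at the saddle point. -/
def amplitudeZero (α θ p b : ℝ) : ℝ :=
  skewTailCoef α * saddle α θ b ^ p * (saddle α θ b / (1 + θ * saddle α θ b) ^ 2)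

theorem amplitudeZero_pos {α : ℝ} (θ p : ℝ) {b : ℝ} (hα : 0 < α) (hb : 0 < b) :
    0 < amplitudeZero α θ p b := by
  have h1 := saddle_pos α θ hb
  have h2 := one_add_mul_saddle_pos α θ hb
  unfold amplitudeZero skewTailCoef
  positivity

theorem measurable_amplitude (α θ p a b t : ℝ) : Measurable (amplitude α θ p a b t) := by
  have hc : Measurable (cdf (skewNormal α)) := (monotone_cdf _).measurable
  unfold amplitude
  have : Measurable fun x : ℝ => cdf (skewNormal α) (-(Real.sqrt t *
      ((1 + θ * (saddle α θ b * Real.exp x)) / Real.sqrt (saddle α θ b * Real.exp x)))) :=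
    hc.comp (by fun_prop)
  fun_prop

/-- The amplitude is within O(1/t), uniformly near 0, of a limit that is C² in x; Taylor's formula
for that limit gives the rest. The interval is small enough that 1 + θu stays positive and the
coefficient of 1/t stays bounded. -/
theorem amplitude_expansion {α : ℝ} (θ p a : ℝ) {b : ℝ} (hα : 0 < α) (hb : 0 < b)
    [IsProbabilityMeasure (skewNormal α)] :
    ∃ η : ℝ, 0 < η ∧ ∃ C : ℝ, 0 ≤ C ∧ ∃ g₁ : ℝ, ∀ t, 1 ≤ t → ∀ x ∈ Set.Icc (-η) η,
      |amplitude α θ p a b t x - amplitudeZero α θ p b - g₁ * x| ≤ C * (x ^ 2 + 1 / t) := by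
  obtain ⟨B, hB, hbd⟩ := scaled_tail_bound θ p a hα
  have hu0 := saddle_pos α θ hb
  have hθ0 := one_add_mul_saddle_pos α θ hb
  set u₀ := saddle α θ b with hu₀
  have hθ0' : (1 + θ * (u₀ * Real.exp 0)) ^ 2 ≠ 0 := by
    rw [Real.exp_zero, mul_one]; positivity
  have hu0' : u₀ * Real.exp 0 ≠ 0 := by positivity
  set g : ℝ → ℝ := fun x => skewTailCoef α * (u₀ * Real.exp x) ^ p *
    (u₀ * Real.exp x / (1 + θ * (u₀ * Real.exp x)) ^ 2) with hg
  have hu : ContDiffAt ℝ 2 (fun x : ℝ => u₀ * Real.exp x) 0 :=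
    (contDiff_const.mul Real.contDiff_exp).contDiffAt
  have hgc : ContDiffAt ℝ 2 g 0 :=
    (contDiffAt_const.mul (hu.rpow_const_of_ne hu0')).mul
      (hu.div ((contDiffAt_const.add (contDiffAt_const.mul hu)).pow 2) hθ0')
  obtain ⟨C₁, hC₁, η₁, hη₁, hT⟩ := eventually_abs_sub_linear_le hgc
  set h : ℝ → ℝ := fun x => (u₀ * Real.exp x) ^ p *
    (B * (u₀ * Real.exp x / (1 + θ * (u₀ * Real.exp x)) ^ 2) ^ 2 +
        skewTailCoef α * (u₀ * Real.exp x / (1 + θ * (u₀ * Real.exp x)) ^ 2) *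
        (a ^ 2 / (2 * (u₀ * Real.exp x)))) with hh
  have hcu : ContinuousAt (fun x : ℝ => u₀ * Real.exp x) 0 := hu.continuousAt
  have hr : ContinuousAt
      (fun x : ℝ => u₀ * Real.exp x / (1 + θ * (u₀ * Real.exp x)) ^ 2) 0 :=
    hcu.div ((continuousAt_const.add (continuousAt_const.mul hcu)).pow 2) hθ0'
  have hhc : ContinuousAt h 0 :=
    (hcu.rpow_const (Or.inl hu0')).mul ((continuousAt_const.mul (hr.pow 2)).add
      ((continuousAt_const.mul hr).mul (continuousAt_const.div (continuousAt_const.mul hcu)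
        (mul_ne_zero two_ne_zero hu0'))))
  have ev1 : ∀ᶠ x in 𝓝 (0 : ℝ), h x < |h 0| + 1 :=
    hhc.eventually_lt continuousAt_const (by linarith [le_abs_self (h 0)])
  have ev2 : ∀ᶠ x in 𝓝 (0 : ℝ), 0 < 1 + θ * (u₀ * Real.exp x) :=
    continuousAt_const.eventually_lt (continuousAt_const.add (continuousAt_const.mul hcu))
      (by simpa using hθ0)
  obtain ⟨η₂, hη₂, hball⟩ := Metric.eventually_nhds_iff_ball.1 (ev1.and ev2)
  refine ⟨min η₁ (η₂ / 2), by positivity, C₁ + (|h 0| + 1), by positivity, deriv g 0,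
    fun t ht x hx => ?_⟩
  have ht0 : 0 < t := by linarith
  have hxa := abs_le.2 hx
  obtain ⟨hx1, hx2⟩ := hball x (by
    rw [mem_ball_zero_iff, Real.norm_eq_abs]
    linarith [min_le_right η₁ (η₂ / 2)])
  have h1 := hT x (hxa.trans (min_le_left _ _))
  have h2 := hbd t (u₀ * Real.exp x) ht0 (by positivity) hx2
  have hg0 : g 0 = amplitudeZero α θ p b := by
    simp only [hg, Real.exp_zero, mul_one, amplitudeZero, ← hu₀]
  have h3 : |amplitude α θ p a b t x - g x| ≤ (|h 0| + 1) * (1 / t) := by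
    refine h2.trans ?_
    exact mul_le_mul_of_nonneg_right hx1.le (by positivity)
  rw [hg0] at h1
  calc _ = |(amplitude α θ p a b t x - g x) +
        (g x - amplitudeZero α θ p b - deriv g 0 * x)| := by congr 1; ring
    _ ≤ (|h 0| + 1) * (1 / t) + C₁ * x ^ 2 := (abs_add_le _ _).trans (add_le_add h3 h1)
    _ ≤ _ := by
      have : 0 ≤ C₁ * (1 / t) := by positivity
      have : 0 ≤ (|h 0| + 1) * x ^ 2 := by positivity
      linarith

/-- The part of the mixture integral near the saddle point in logarithmic coordinates. -/
theorem setIntegral_near_saddle {α : ℝ} (θ p a : ℝ) {b t η : ℝ} (hb : 0 < b) (ht : 0 < t) :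
    ∫ w in (fun x => t * (saddle α θ b * Real.exp x)) '' Set.Icc (-η) η,
      gigPDF p a b w * cdf (skewNormal α) ((-t - θ * w) / Real.sqrt w) =
    1 / (2 * barK p a b) * t ^ (p - 1) * Real.exp (-t * (phiAlpha α θ b + θ)) *
      ∫ x in Set.Icc (-η) η, amplitude α θ p a b t x *
        Real.exp (-(Real.sqrt (1 + α ^ 2) * betaParam α θ b * t * (Real.cosh x - 1))) := by
  have hu0 := saddle_pos α θ hb
  have hder : ∀ x ∈ Set.Icc (-η) η,
      HasDerivWithinAt (fun x => t * (saddle α θ b * Real.exp x))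
        (t * (saddle α θ b * Real.exp x)) (Set.Icc (-η) η) x := fun x _ =>
    (((Real.hasDerivAt_exp x).const_mul _).const_mul _).hasDerivWithinAt
  have hinj : Set.InjOn (fun x => t * (saddle α θ b * Real.exp x)) (Set.Icc (-η) η) := by
    intro x _ y _ hxy
    exact Real.exp_injective (mul_left_cancel₀ hu0.ne' (mul_left_cancel₀ ht.ne' hxy))
  rw [integral_image_eq_integral_abs_deriv_smul measurableSet_Icc hder hinj,
    ← integral_const_mul]
  refine integral_congr_ae (ae_of_all _ fun x => ?_)
  have hid := phase_identity α θ hb x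
  have hu : 0 < saddle α θ b * Real.exp x := by positivity
  simp only [smul_eq_mul, amplitude]
  set u := saddle α θ b * Real.exp x
  have htu : 0 < t * u := mul_pos ht hu
  have harg : (-t - θ * (t * u)) / Real.sqrt (t * u) =
      -(Real.sqrt t * ((1 + θ * u) / Real.sqrt u)) := by
    rw [Real.sqrt_mul ht.le]
    have h1 : 0 < Real.sqrt t := Real.sqrt_pos.2 ht
    have h2 : 0 < Real.sqrt u := Real.sqrt_pos.2 hu
    have h3 : Real.sqrt t ^ 2 = t := Real.sq_sqrt ht.le
    field_simp
    rw [h3]; ring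
  -- The Jacobian tu raises w^(p-1) to t^p u^p; one factor t goes into the amplitude, leaving
  -- t^(p-1) outside.
  rw [harg, gigPDF, if_pos htu, abs_of_pos htu, Real.mul_rpow ht.le hu.le,
    Real.rpow_sub_one hu.ne']
  set H := cdf (skewNormal α) (-(Real.sqrt t * ((1 + θ * u) / Real.sqrt u)))
  have hexp : Real.exp (-(1 / 2) * (a ^ 2 * (t * u)⁻¹ + b ^ 2 * (t * u))) =
      Real.exp (-t * (phiAlpha α θ b + θ)) * (Real.exp (-(a ^ 2 / (2 * (t * u)))) *
        (Real.exp ((1 + α ^ 2) * (t * ((1 + θ * u) ^ 2 / u)) / 2) *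
        Real.exp (-(Real.sqrt (1 + α ^ 2) * betaParam α θ b * t * (Real.cosh x - 1))))) := by
    rw [← Real.exp_add, ← Real.exp_add, ← Real.exp_add]
    congr 1
    have e1 : a ^ 2 * (t * u)⁻¹ = 2 * (a ^ 2 / (2 * (t * u))) := by field_simp
    rw [e1]
    linear_combination (-t) * hid
  rw [hexp]
  field_simp

/-! ### Contribution away from the saddle point. -/

theorem exists_exp_neg_inv_le {p a : ℝ} (ha : 0 ≤ a) (hp : a = 0 → 0 < p) :
    ∃ q C : ℝ, 0 < q ∧ 0 ≤ C ∧ ∀ w, 0 < w →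
      w ^ (p - 1) * Real.exp (-(1 / 2) * (a ^ 2 * w⁻¹)) ≤ C * w ^ (q - 1) := by
  rcases ha.eq_or_lt with rfl | ha
  · exact ⟨p, 1, hp rfl, zero_le_one, fun w hw => by simp⟩
  -- For a > 0 the bound eʸ ≥ yⁿ/n! at y = a²/(2w) gains a factor wⁿ; n > -p makes the result
  -- integrable at 0.
  · obtain ⟨n, hn⟩ := exists_nat_gt (-p)
    refine ⟨p + n, (n.factorial : ℝ) * (2 / a ^ 2) ^ n, by linarith, by positivity,
      fun w hw => ?_⟩
    have hy : 0 ≤ a ^ 2 / (2 * w) := by positivity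
    have h := Real.pow_div_factorial_le_exp _ hy n
    have hf : (0 : ℝ) < n.factorial := by exact_mod_cast n.factorial_pos
    have he : Real.exp (-(1 / 2) * (a ^ 2 * w⁻¹)) * Real.exp (a ^ 2 / (2 * w)) = 1 := by
      rw [← Real.exp_add, Real.exp_eq_one_iff]; field_simp; ring
    have h1 : Real.exp (-(1 / 2) * (a ^ 2 * w⁻¹)) ≤
        n.factorial * (2 / a ^ 2) ^ n * w ^ n := by
      have h2 := mul_le_mul_of_nonneg_left h (Real.exp_pos (-(1 / 2) * (a ^ 2 * w⁻¹))).le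
      rw [he] at h2
      have e : (n.factorial : ℝ) * (2 / a ^ 2) ^ n * w ^ n =
        1 / ((a ^ 2 / (2 * w)) ^ n / n.factorial) := by
        rw [div_pow, div_pow, mul_pow]; field_simp
      rw [e, le_div_iff₀ (by positivity)]
      exact h2
    rw [show p + n - 1 = (p - 1) + (n : ℝ) by ring, Real.rpow_add hw, Real.rpow_natCast]
    have := mul_le_mul_of_nonneg_left h1 (Real.rpow_pos_of_pos hw (p - 1)).le
    linarith

/-- The rate c is free because the remainder estimate keeps only a small part of the decay
exp(-b²w/2). -/
theorem integrableOn_gig_kernel {p a c : ℝ} (ha : 0 ≤ a) (hp : a = 0 → 0 < p) (hc : 0 < c) :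
    IntegrableOn (fun w => w ^ (p - 1) * Real.exp (-(1 / 2) * (a ^ 2 * w⁻¹)) *
      Real.exp (-c * w)) (Set.Ioi 0) := by
  obtain ⟨q, C, hq, hC, hbd⟩ := exists_exp_neg_inv_le ha hp
  have hi : IntegrableOn (fun w : ℝ => C * (w ^ (q - 1) * Real.exp (-c * w ^ (1 : ℝ))))
      (Set.Ioi 0) :=
    (integrableOn_rpow_mul_exp_neg_mul_rpow (by linarith) one_pos hc).const_mul C
  refine Integrable.mono' hi (Measurable.aestronglyMeasurable (by fun_prop)) ?_
  filter_upwards [ae_restrict_mem measurableSet_Ioi] with w hw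
  have hw : 0 < w := hw
  rw [Real.norm_eq_abs, abs_of_nonneg (by positivity), Real.rpow_one, ← mul_assoc C]
  exact mul_le_mul_of_nonneg_right (hbd w hw) (Real.exp_pos _).le

theorem integrableOn_gigPDF_mul {p a b : ℝ} (ha : 0 ≤ a) (hb : 0 < b) (hp : a = 0 → 0 < p)
    (hK : 0 < barK p a b) {f : ℝ → ℝ} (hf : Measurable f) (h0 : ∀ w, 0 ≤ f w)
    (h1 : ∀ w, f w ≤ 1) :
    IntegrableOn (fun w => gigPDF p a b w * f w) (Set.Ioi 0) := by
  have hi := (integrableOn_gig_kernel (p := p) ha hp (c := b ^ 2 / 2) (by positivity)).const_mul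
    (1 / (2 * barK p a b))
  refine Integrable.mono' hi ((measurable_gigPDF p a b).mul hf).aestronglyMeasurable ?_
  filter_upwards [ae_restrict_mem measurableSet_Ioi] with w hw
  have hw : 0 < w := hw
  have hg := gigPDF_nonneg hK w
  rw [Real.norm_eq_abs, abs_of_nonneg (mul_nonneg hg (h0 w))]
  refine (mul_le_of_le_one_right hg (h1 w)).trans_eq ?_
  rw [gigPDF, if_pos hw, mul_assoc, mul_assoc, ← Real.exp_add]
  ring_nf

/-- Away from the saddle point the exponent exceeds its minimum by a fixed amount. -/
theorem exponent_gap (α θ : ℝ) {b η : ℝ} (hb : 0 < b) (hη : 0 < η) :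
    ∃ κ : ℝ, 0 < κ ∧ ∀ u, 0 < u →
      u ∉ (fun x => saddle α θ b * Real.exp x) '' Set.Icc (-η) η →
      phiAlpha α θ b + θ + κ ≤
        (1 + α ^ 2) * ((max 0 (1 + θ * u)) ^ 2 / u) / 2 + b ^ 2 * u / 2 := by
  have hu0 := saddle_pos α θ hb
  have hβ := betaParam_pos α θ hb
  have hs0 : 0 < Real.sqrt (1 + α ^ 2) := Real.sqrt_pos.2 (by positivity)
  have hs2 : Real.sqrt (1 + α ^ 2) ^ 2 = 1 + α ^ 2 := Real.sq_sqrt (by positivity)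
  have hl : 0 < Real.sqrt (1 + α ^ 2) * betaParam α θ b := by positivity
  -- The right side is the phase at u = -1/θ, where 1 + θu vanishes. After clearing the denominator
  -- the gap is (β - |θ|s)² > 0.
  have gap : θ < 0 → phiAlpha α θ b + θ < b ^ 2 / (2 * -θ) := by
    intro hθ
    have h1 := abs_mul_sqrt_lt_betaParam α θ hb
    rw [abs_of_neg hθ] at h1
    rw [lt_div_iff₀ (by linarith), phiAlpha_add]
    have hb2 := betaParam_sq α θ b
    rw [← hs2] at hb2
    nlinarith [sq_pos_of_pos (sub_pos.2 h1)]
  refine ⟨min (Real.sqrt (1 + α ^ 2) * betaParam α θ b * (η ^ 2 / 2))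
    (if θ < 0 then b ^ 2 / (2 * -θ) - (phiAlpha α θ b + θ) else 1), ?_, fun u hu hmem => ?_⟩
  · refine lt_min (by positivity) ?_
    split_ifs with h
    · linarith [gap h]
    · exact one_pos
  · rcases le_or_gt 0 (1 + θ * u) with h | h
    · rw [max_eq_right h]
      set x := Real.log (u / saddle α θ b) with hx
      have hux : saddle α θ b * Real.exp x = u := by
        rw [hx, Real.exp_log (by positivity)]; field_simp
      have hid := phase_identity α θ hb x
      rw [hux] at hid
      rw [hid]
      have hxη : η < |x| := by
        by_contra! hc
        exact hmem ⟨x, abs_le.1 hc, hux⟩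
      have h2 : η ^ 2 ≤ x ^ 2 := by rw [← sq_abs x]; gcongr
      have h3 := one_add_sq_div_two_le_cosh x
      have h4 : Real.sqrt (1 + α ^ 2) * betaParam α θ b * (η ^ 2 / 2) ≤
          Real.sqrt (1 + α ^ 2) * betaParam α θ b * (Real.cosh x - 1) :=
        mul_le_mul_of_nonneg_left (by linarith) hl.le
      linarith [min_le_left (Real.sqrt (1 + α ^ 2) * betaParam α θ b * (η ^ 2 / 2))
        (if θ < 0 then b ^ 2 / (2 * -θ) - (phiAlpha α θ b + θ) else 1)]
    · have hθ : θ < 0 := by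
        by_contra! hc
        nlinarith [mul_nonneg hc hu.le]
      rw [max_eq_left h.le, if_pos hθ]
      have h1 : b ^ 2 / (2 * -θ) ≤ b ^ 2 * u / 2 := by
        rw [div_le_iff₀ (by linarith)]
        nlinarith [sq_pos_of_pos hb]
      have h2 := min_le_right (Real.sqrt (1 + α ^ 2) * betaParam α θ b * (η ^ 2 / 2))
        (b ^ 2 / (2 * -θ) - (phiAlpha α θ b + θ))
      simp only [ne_eq, OfNat.ofNat_ne_zero, not_false_eq_true, zero_pow, zero_div, mul_zero]
      linarith

theorem setIntegral_away_from_saddle {α : ℝ} (θ : ℝ) {p a b η : ℝ} (hα : 0 < α) (ha : 0 ≤ a)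
    (hb : 0 < b) (hp : a = 0 → 0 < p) (hK : 0 < barK p a b) (hη : 0 < η)
    [IsProbabilityMeasure (skewNormal α)] :
    ∃ κ D : ℝ, 0 < κ ∧ ∀ t, 0 < t →
      |∫ w in Set.Ioi 0 \ (fun x => t * (saddle α θ b * Real.exp x)) '' Set.Icc (-η) η,
        gigPDF p a b w * cdf (skewNormal α) ((-t - θ * w) / Real.sqrt w)| ≤
      D * Real.exp (-t * (phiAlpha α θ b + θ + κ)) := by
  obtain ⟨κ, hκ, hgap⟩ := exponent_gap α θ hb hη
  obtain ⟨C, hC, hexp⟩ := cdf_skewNormal_neg_le_exp hα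
  have hΦ := phiAlpha_add_pos α θ hb
  set Φ := phiAlpha α θ b + θ
  -- A fraction ε of the exponent is kept for integrability in w; the remaining 1 - ε still yields
  -- the rate Φ + κ/2.
  set ε := κ / (2 * (Φ + κ)) with hε
  have hε0 : 0 < ε := by positivity
  have hε1 : ε < 1 := by rw [hε, div_lt_one (by positivity)]; linarith
  have hεΦ : (1 - ε) * (Φ + κ) = Φ + κ / 2 := by rw [hε]; field_simp; ring
  have hker := integrableOn_gig_kernel (p := p) ha hp (c := ε * (b ^ 2 / 2)) (by positivity)
  set k : ℝ → ℝ := fun w => w ^ (p - 1) * Real.exp (-(1 / 2) * (a ^ 2 * w⁻¹)) *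
      Real.exp (-(ε * (b ^ 2 / 2)) * w) with hk
  set K₀ := 1 / (2 * barK p a b) with hK₀
  have hK₀0 : 0 < K₀ := by positivity
  refine ⟨κ / 2, K₀ * (C + 1) * ∫ w in Set.Ioi 0, k w, by positivity, fun t ht => ?_⟩
  set S := (fun x => t * (saddle α θ b * Real.exp x)) '' Set.Icc (-η) η with hS
  have hSm : MeasurableSet S :=
    (isCompact_Icc.image (by fun_prop : Continuous fun x =>
      t * (saddle α θ b * Real.exp x))).measurableSet
  have hint : IntegrableOn (fun w => K₀ * (C + 1) * Real.exp (-t * (Φ + κ / 2)) * k w)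
      (Set.Ioi 0) := hker.const_mul _
  have hpt : ∀ w ∈ Set.Ioi 0 \ S,
      ‖gigPDF p a b w * cdf (skewNormal α) ((-t - θ * w) / Real.sqrt w)‖ ≤
        K₀ * (C + 1) * Real.exp (-t * (Φ + κ / 2)) * k w := by
    rintro w ⟨hw, hwS⟩
    have hw : 0 < w := hw
    have hu : 0 < w / t := by positivity
    have hg := hgap (w / t) hu (fun ⟨x, hx, hxu⟩ => hwS ⟨x, hx, by
      simp only at hxu ⊢
      rw [hxu]; field_simp⟩)
    set L := (1 + α ^ 2) * ((max 0 (t + θ * w)) ^ 2 / w) / 2 + b ^ 2 * w / 2 with hL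
    have hmax : max 0 (1 + θ * (w / t)) = max 0 (t + θ * w) / t := by
      rw [max_div_div_right ht.le 0 (t + θ * w) |>.symm, zero_div]
      congr 1; field_simp
    have hLt : t * ((1 + α ^ 2) * ((max 0 (1 + θ * (w / t))) ^ 2 / (w / t)) / 2 +
        b ^ 2 * (w / t) / 2) = L := by
      rw [hmax, hL]; field_simp
    have hL1 : t * (Φ + κ) ≤ L := by
      rw [← hLt]; exact mul_le_mul_of_nonneg_left hg ht.le
    -- When t + θw < 0 the argument is positive and only the bound 1 is available, hence the
    -- truncation at 0 and the constant C + 1.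
    have hcdf : cdf (skewNormal α) ((-t - θ * w) / Real.sqrt w) ≤
        (C + 1) * Real.exp (-((1 + α ^ 2) * ((max 0 (t + θ * w)) ^ 2 / w) / 2)) := by
      rcases le_or_gt 0 (t + θ * w) with h | h
      · have h1 := hexp ((t + θ * w) / Real.sqrt w) (by positivity)
        rw [div_pow, Real.sq_sqrt hw.le] at h1
        rw [max_eq_right h, show (-t - θ * w) / Real.sqrt w = -((t + θ * w) / Real.sqrt w) by ring]
        refine h1.trans ?_
        gcongr
        linarith
      · rw [max_eq_left h.le]
        refine (cdf_le_one _ _).trans ?_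
        simp [hC.le]
    have hg0 := gigPDF_nonneg hK w
    rw [Real.norm_eq_abs, abs_of_nonneg (mul_nonneg hg0 (cdf_nonneg _ _))]
    refine (mul_le_mul_of_nonneg_left hcdf hg0).trans ?_
    rw [gigPDF, if_pos hw, ← hK₀]
    have e1 : K₀ * w ^ (p - 1) * Real.exp (-(1 / 2) * (a ^ 2 * w⁻¹ + b ^ 2 * w)) *
        ((C + 1) * Real.exp (-((1 + α ^ 2) * ((max 0 (t + θ * w)) ^ 2 / w) / 2))) =
        K₀ * (C + 1) * (w ^ (p - 1) * Real.exp (-(1 / 2) * (a ^ 2 * w⁻¹))) * Real.exp (-L) := by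
      have e2 : Real.exp (-(1 / 2) * (a ^ 2 * w⁻¹ + b ^ 2 * w)) *
          Real.exp (-((1 + α ^ 2) * ((max 0 (t + θ * w)) ^ 2 / w) / 2)) =
          Real.exp (-(1 / 2) * (a ^ 2 * w⁻¹)) * Real.exp (-L) := by
        rw [← Real.exp_add, ← Real.exp_add, hL]; congr 1; ring
      linear_combination K₀ * w ^ (p - 1) * (C + 1) * e2
    rw [e1]
    have hLb : b ^ 2 * w / 2 ≤ L := by
      have : 0 ≤ (1 + α ^ 2) * ((max 0 (t + θ * w)) ^ 2 / w) / 2 := by positivity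
      linarith
    have hL2 : t * (Φ + κ / 2) + ε * (b ^ 2 / 2) * w ≤ L := by
      have h1 : (1 - ε) * (t * (Φ + κ)) ≤ (1 - ε) * L :=
        mul_le_mul_of_nonneg_left hL1 (by linarith)
      have h2 : ε * (b ^ 2 * w / 2) ≤ ε * L := mul_le_mul_of_nonneg_left hLb hε0.le
      have h3 : (1 - ε) * (t * (Φ + κ)) = t * (Φ + κ / 2) := by rw [← hεΦ]; ring
      linarith
    have e3 : Real.exp (-L) ≤ Real.exp (-t * (Φ + κ / 2)) *
        Real.exp (-(ε * (b ^ 2 / 2)) * w) := by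
      rw [← Real.exp_add, Real.exp_le_exp]; linarith
    calc _ ≤ K₀ * (C + 1) * (w ^ (p - 1) * Real.exp (-(1 / 2) * (a ^ 2 * w⁻¹))) *
          (Real.exp (-t * (Φ + κ / 2)) * Real.exp (-(ε * (b ^ 2 / 2)) * w)) := by gcongr
      _ = _ := by rw [hk]; ring
  rw [← Real.norm_eq_abs]
  have hk0 : ∀ w ∈ Set.Ioi (0 : ℝ), 0 ≤ K₀ * (C + 1) * Real.exp (-t * (Φ + κ / 2)) * k w := by
    intro w hw
    have hw : 0 < w := hw
    rw [hk]; positivity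
  calc _ ≤ ∫ w in Set.Ioi 0 \ S, K₀ * (C + 1) * Real.exp (-t * (Φ + κ / 2)) * k w := by
        refine norm_integral_le_of_norm_le (hint.mono_set Set.sdiff_subset) ?_
        filter_upwards [ae_restrict_mem (measurableSet_Ioi.diff hSm)] with w hw using hpt w hw
    _ ≤ ∫ w in Set.Ioi 0, K₀ * (C + 1) * Real.exp (-t * (Φ + κ / 2)) * k w :=
        setIntegral_mono_set hint
          ((ae_restrict_iff' measurableSet_Ioi).2 (ae_of_all _ hk0))
          (ae_of_all _ fun _ h => Set.sdiff_subset h)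
    _ = _ := by rw [integral_const_mul]; ring

/-! ### Matching the constant and assembling the asymptotics. -/

/-- The right side is what Laplace's method produces: density normalizer, amplitude at the saddle,
Gaussian integral with curvature sβ. -/
theorem tailConst_eq {α θ p a b : ℝ} (hα : 0 < α) (hb : 0 < b) (hK : 0 < barK p a b) :
    tailConst α θ p a b = 1 / (2 * barK p a b) * amplitudeZero α θ p b *
      Real.sqrt (2 * Real.pi / (Real.sqrt (1 + α ^ 2) * betaParam α θ b)) := by
  have hβ := betaParam_pos α θ hb
  have hs := betaParam_add_pos α θ hb
  have h1 : 0 < 1 + α ^ 2 := by positivity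
  have hs0 : 0 < Real.sqrt (1 + α ^ 2) := Real.sqrt_pos.2 h1
  have hs2 : Real.sqrt (1 + α ^ 2) ^ 2 = 1 + α ^ 2 := Real.sq_sqrt h1.le
  have e1 : (1 + α ^ 2) ^ ((p - 1 / 2) / 2) = Real.sqrt (1 + α ^ 2) ^ (p - 1 / 2) := by
    rw [Real.sqrt_eq_rpow, ← Real.rpow_mul h1.le]; congr 1; ring
  rw [tailConst, thetaTildeZero, amplitudeZero, skewTailCoef, saddle, phiAlpha_add, e1,
    Real.rpow_sub hs0, Real.rpow_sub hβ, ← Real.sqrt_eq_rpow, ← Real.sqrt_eq_rpow,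
    Real.div_rpow hs0.le hβ.le, Real.sqrt_div (by positivity), Real.sqrt_mul hs0.le]
  set s := Real.sqrt (1 + α ^ 2)
  rw [← hs2]
  set β := betaParam α θ b
  have hsp : 0 < s ^ p := Real.rpow_pos_of_pos hs0 p
  have hβp : 0 < β ^ p := Real.rpow_pos_of_pos hβ p
  have hrs : 0 < Real.sqrt s := Real.sqrt_pos.2 hs0
  have hrb : 0 < Real.sqrt β := Real.sqrt_pos.2 hβ
  have hrb2 : Real.sqrt β ^ 2 = β := Real.sq_sqrt hβ.le
  have hq : 0 < Real.sqrt (2 * Real.pi) := Real.sqrt_pos.2 (by positivity)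
  have hq2 : Real.sqrt (2 * Real.pi) ^ 2 = 2 * Real.pi := Real.sq_sqrt (by positivity)
  have e2 : 1 + θ * (s / β) = (β + θ * s) / β := by field_simp
  rw [e2]
  have hpi : Real.pi = Real.sqrt (2 * Real.pi) ^ 2 / 2 := by linarith
  set q := Real.sqrt (2 * Real.pi)
  rw [hpi]
  have := Real.pi_pos
  field_simp
  rw [hrb2]

/-- The exact lower tail asymptotics of the mixture integral. -/
theorem mixture_tail_isBigO {α : ℝ} (θ : ℝ) {p a b : ℝ} (hα : 0 < α) (ha : 0 ≤ a)
    (hb : 0 < b) (hp : a = 0 → 0 < p) (hK : 0 < barK p a b)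
    [IsProbabilityMeasure (skewNormal α)] :
    (fun t : ℝ => (∫ w in Set.Ioi 0, gigPDF p a b w *
        cdf (skewNormal α) ((-t - θ * w) / Real.sqrt w)) /
      (tailConst α θ p a b * t ^ (p - 3 / 2) * Real.exp (-t * (phiAlpha α θ b + θ))) - 1)
      =O[atTop] fun t => 1 / t := by
  obtain ⟨η, hη, C, hC, g₁, hexp⟩ := amplitude_expansion θ p a hα hb
  have hβ := betaParam_pos α θ hb
  have hs0 : 0 < Real.sqrt (1 + α ^ 2) := Real.sqrt_pos.2 (by positivity)
  have hl : 0 < Real.sqrt (1 + α ^ 2) * betaParam α θ b := by positivity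
  obtain ⟨D, hD⟩ := laplace_cosh hl hη hC hexp (measurable_amplitude α θ p a b)
  obtain ⟨κ, D', hκ, haway⟩ := setIntegral_away_from_saddle θ hα ha hb hp hK hη
  have hg0 := amplitudeZero_pos θ p hα hb
  have hT0 := tailConst_pos (θ := θ) hα hb hK
  -- The exponent p - 5/2 is that of the main term divided by t, so the remainder fits into the
  -- O(1/t).
  have hdec := (isLittleO_exp_neg_mul_rpow_atTop hκ (p - 5 / 2)).bound one_pos
  refine IsBigO.of_bound (D / amplitudeZero α θ p b + |D'| / tailConst α θ p a b) ?_
  filter_upwards [hdec, eventually_ge_atTop 1] with t hdt ht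
  have ht0 : 0 < t := by linarith
  set S := (fun x => t * (saddle α θ b * Real.exp x)) '' Set.Icc (-η) η with hS
  have hSm : MeasurableSet S :=
    (isCompact_Icc.image (by fun_prop : Continuous fun x =>
      t * (saddle α θ b * Real.exp x))).measurableSet
  have hSsub : S ⊆ Set.Ioi 0 := by
    rintro _ ⟨x, -, rfl⟩
    have := saddle_pos α θ hb
    exact Set.mem_Ioi.2 (by positivity)
  have hcm : Measurable fun w => cdf (skewNormal α) ((-t - θ * w) / Real.sqrt w) :=
    (monotone_cdf _).measurable.comp (by fun_prop)
  have hint := integrableOn_gigPDF_mul ha hb hp hK hcm (fun _ => cdf_nonneg _ _)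
    (fun _ => cdf_le_one _ _)
  have hsplit := integral_inter_add_sdiff hSm hint
  rw [Set.inter_eq_right.2 hSsub, hS, setIntegral_near_saddle θ p a hb ht0] at hsplit
  have hDt := hD t ht
  have haw := haway t ht0
  rw [tailConst_eq hα hb hK] at hT0 ⊢
  set A₀ := amplitudeZero α θ p b
  set l := Real.sqrt (1 + α ^ 2) * betaParam α θ b
  set Φ := phiAlpha α θ b + θ
  set K₀ := 1 / (2 * barK p a b) with hK₀
  have hK₀0 : 0 < K₀ := by positivity
  set I := ∫ x in Set.Icc (-η) η, amplitude α θ p a b t x *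
        Real.exp (-(l * t * (Real.cosh x - 1)))
  set R := ∫ w in Set.Ioi 0 \ (fun x => t * (saddle α θ b * Real.exp x)) '' Set.Icc (-η) η,
        gigPDF p a b w * cdf (skewNormal α) ((-t - θ * w) / Real.sqrt w)
  rw [← hsplit]
  set q := Real.sqrt (2 * Real.pi / l) with hq
  have hq0 : 0 < q := Real.sqrt_pos.2 (by positivity)
  have hqt : Real.sqrt (2 * Real.pi / (l * t)) = q / Real.sqrt t := by
    rw [hq, ← Real.sqrt_div (by positivity)]; congr 1; field_simp
  rw [hqt] at hDt
  -- The Gaussian width t^(-1/2) lowers the power p - 1 to p - 3/2.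
  have htp : t ^ (p - 3 / 2) = t ^ (p - 1) / Real.sqrt t := by
    rw [Real.sqrt_eq_rpow, ← Real.rpow_sub ht0]; congr 1; ring
  have htp2 : t ^ (p - 5 / 2) = t ^ (p - 3 / 2) / t := by
    rw [← Real.rpow_sub_one ht0.ne']; congr 1; ring
  have hrt : 0 < Real.sqrt t := Real.sqrt_pos.2 ht0
  have hE : 0 < Real.exp (-t * Φ) := Real.exp_pos _
  set E := Real.exp (-t * Φ)
  have hX : 0 < t ^ (p - 1) := Real.rpow_pos_of_pos ht0 _
  set X := t ^ (p - 1)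
  set T := K₀ * A₀ * q * t ^ (p - 3 / 2) * E with hT
  have hTpos : 0 < T := by rw [hT, htp]; positivity
  have hR : |R| ≤ |D'| / (K₀ * A₀ * q) * (1 / t) * T := by
    have h1 : Real.exp (-t * (Φ + κ)) = E * Real.exp (-κ * t) := by
      rw [← Real.exp_add]; congr 1; ring
    rw [h1] at haw
    have h2 : Real.exp (-κ * t) ≤ t ^ (p - 3 / 2) / t := by
      rw [one_mul, Real.norm_eq_abs, Real.abs_exp, Real.norm_eq_abs,
        abs_of_pos (Real.rpow_pos_of_pos ht0 _), htp2] at hdt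
      exact hdt
    calc |R| ≤ D' * (E * Real.exp (-κ * t)) := haw
      _ ≤ |D'| * (E * (t ^ (p - 3 / 2) / t)) := by
        have := le_abs_self D'
        gcongr
      _ = _ := by rw [hT]; field_simp
  have hI : |K₀ * X * E * I - T| ≤ D / A₀ * (1 / t) * T := by
    have e1 : K₀ * X * E * I - T = K₀ * X * E * (I - A₀ * (q / Real.sqrt t)) := by
      rw [hT, htp]; ring
    rw [e1, abs_mul, abs_of_pos (by positivity)]
    calc _ ≤ K₀ * X * E * (D / t * (q / Real.sqrt t)) := by gcongr
      _ = _ := by rw [hT, htp]; field_simp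
  have e2 : (K₀ * X * E * I + R) / T - 1 = ((K₀ * X * E * I - T) + R) / T := by
    field_simp; ring
  rw [e2, Real.norm_eq_abs, abs_div, abs_of_pos hTpos, div_le_iff₀ hTpos, Real.norm_eq_abs,
    abs_of_pos (by positivity : 0 < 1 / t)]
  calc _ ≤ |K₀ * X * E * I - T| + |R| := abs_add_le _ _
    _ ≤ D / A₀ * (1 / t) * T + |D'| / (K₀ * A₀ * q) * (1 / t) * T := add_le_add hI hR
    _ = _ := by ring

end EquiSkewGH

end

theorem mainTheorem2
    (ρ θ p a b : ℝ) (hρ₁ : -1 < ρ) (hρ₂ : ρ < 1)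
    (ha : 0 ≤ a) (hb : 0 < b) (hp : a = 0 → 0 < p)
    {Ω : Type*} [MeasurableSpace Ω] (P : Measure Ω) [IsProbabilityMeasure P]
    (X : Ω → EuclideanSpace ℝ (Fin 2))
    (hX : HasLaw X (EquiSkewGH.bivariateGH ρ !₂[θ, θ] p a b) P)
    {Ω' : Type*} [MeasurableSpace Ω'] (P' : Measure Ω') [IsProbabilityMeasure P']
    (W : Ω' → ℝ) (Z : Ω' → EuclideanSpace ℝ (Fin 2))
    (hW : HasLaw W (EquiSkewGH.gig p a b) P')
    (hZ : HasLaw Z (EquiSkewGH.bivariateNormal ρ) P')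
    (hWZ : IndepFun W Z P') :
    HasLaw (fun ω => max (Z ω 0) (Z ω 1))
        (EquiSkewGH.skewNormal (EquiSkewGH.skewParam ρ)) P' ∧
    (∀ y : ℝ, P.real {ω | X ω 0 ≤ y ∧ X ω 1 ≤ y} =
        P'.real {ω | θ * W ω + Real.sqrt (W ω) * max (Z ω 0) (Z ω 1) ≤ y}) ∧
    EquiSkewGH.phiAlpha (EquiSkewGH.skewParam ρ) θ b + θ =
        Real.sqrt (1 + EquiSkewGH.skewParam ρ ^ 2) *
          (EquiSkewGH.betaParam (EquiSkewGH.skewParam ρ) θ b +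
            θ * Real.sqrt (1 + EquiSkewGH.skewParam ρ ^ 2)) ∧
    0 < EquiSkewGH.phiAlpha (EquiSkewGH.skewParam ρ) θ b + θ ∧
    0 < EquiSkewGH.tailConst (EquiSkewGH.skewParam ρ) θ p a b ∧
    ∃ ε : ℝ → ℝ, ε =O[atBot] (fun y : ℝ => 1 / |y|) ∧
      ∀ y : ℝ, y < 0 →
        P.real {ω | X ω 0 ≤ y ∧ X ω 1 ≤ y} =
          EquiSkewGH.tailConst (EquiSkewGH.skewParam ρ) θ p a b * |y| ^ (p - 3 / 2) *
            Real.exp (-|y| * (EquiSkewGH.phiAlpha (EquiSkewGH.skewParam ρ) θ b + θ)) *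
            (1 + ε y) := by
  -- That the density is normalized follows from W having this law under a probability measure.
  have hpr : IsProbabilityMeasure (EquiSkewGH.gig p a b) :=
    hW.isProbabilityMeasure_iff.1 inferInstance
  have hα := EquiSkewGH.skewParam_pos hρ₁ hρ₂
  have hK : 0 < EquiSkewGH.barK p a b := EquiSkewGH.barK_pos
  have := EquiSkewGH.isProbabilityMeasure_skewNormal hρ₁ hρ₂
  have hT := EquiSkewGH.tailConst_pos (θ := θ) hα hb hK
  have hO := EquiSkewGH.mixture_tail_isBigO θ hα ha hb hp hK
  -- The error function is the exact ratio minus one at t = |y|, so the formula is an identity for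
  -- every y < 0 and only its decay needs the asymptotics.
  refine ⟨EquiSkewGH.hasLaw_max hρ₁ hρ₂ hZ, fun y => ?_, EquiSkewGH.phiAlpha_add _ _ _,
    EquiSkewGH.phiAlpha_add_pos _ _ hb, hT, _, hO.comp_tendsto tendsto_abs_atBot_atTop,
    fun y hy => ?_⟩
  · rw [EquiSkewGH.measureReal_lower_orthant hX, EquiSkewGH.measureReal_scaled_max hW hZ hWZ]
  · rw [EquiSkewGH.measureReal_lower_orthant hX,
      EquiSkewGH.measureReal_prod_eq_integral hρ₁ hρ₂]
    have hy0 : 0 < |y| := abs_pos.2 hy.ne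
    have hy' : -|y| = y := by rw [abs_of_neg hy, neg_neg]
    simp only [Function.comp_apply]
    have hpos : 0 < EquiSkewGH.tailConst (EquiSkewGH.skewParam ρ) θ p a b * |y| ^ (p - 3 / 2) *
        Real.exp (-|y| * (EquiSkewGH.phiAlpha (EquiSkewGH.skewParam ρ) θ b + θ)) := by positivity
    rw [add_sub_cancel, mul_div_cancel₀ _ hpos.ne', hy']
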